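/- All triangulated categories are $\mathbb{C}$-linear of finite type, i.e. $\sum_{i}\dim_{\mathbb C}\mathrm{Hom}(E,F[i])<\infty$ for all objects $E,F$; functors between them are $\mathbb{C}$-linear. Write $\chi(E,F)=\sum_i(-1)^i\dim\mathrm{Hom}(E,F[i])$ and $\mathrm{K}_{\mathrm{num}}(\mathcal T)=\mathrm{K}(\mathcal T)/\ker\chi$. A stability condition $\sigma=(Z,\mathcal A)$ on $\mathcal T$ consists of the heart $\mathcal A$ of a bounded t-structure and a homomorphism $Z\colon \mathrm{K}_{\mathrm{num}}(\mathcal T)\to\mathbb C$ ($\mathrm{K}_{\mathrm{num}}(\mathcal T)$ of finite rank) such that $Z$ is a stability function on $\mathcal A$, Harder–Narasimhan filtrations exist in $\mathcal A$, and the support property holds. A nonzero $A\in\mathcal A$ is $\sigma$-(semi)stable if $\mu_\sigma(A')<\mu_\sigma(A)$ (resp. $\le$) for all nonzero proper subobjects $A'\subset A$ in $\mathcal A$, where $\mu_\sigma=-\mathrm{Re}\,Z/\mathrm{Im}\,Z$ ($=+\infty$ if $\mathrm{Im}\,Z=0$); its phase is $\frac1\pi\arg Z(A)\in(0,1]$.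 An object of $\mathcal T$ is $\sigma$-(semi)stable of phase $\phi+n$ if it is isomorphic to $A[n]$ with $n\in\mathbb Z$ and $A\in\mathcal A$ $\sigma$-(semi)stable of phase $\phi$. For an auto-equivalence $T$, $\sigma$ is $T$-invariant if $T\cdot\sigma=\sigma\cdot\tilde g$ for some $\tilde g\in\widetilde{\mathrm{GL}}^+(2,\mathbb R)$. **Theorem.** Let $\mathcal K_1,\mathcal K_2$ be triangulated categories with the following properties. - (C1) $\mathrm{K}_{\mathrm{num}}(\mathcal K_1)=\mathbb Z\lambda_1\oplus\mathbb Z\lambda_2$ with Euler pairing $\begin{pmatrix}-1&0\\0&-1\end{pmatrix}$. - (C2) $\mathrm{K}_{\mathrm{num}}(\mathcal K_2)=\mathbb Z\Lambda_1\oplus\mathbb Z\Lambda_2$ with Euler pairing $\begin{pmatrix}-2&0\\0&-2\end{pmatrix}$. - (C3) There are exact auto-equivalences $T_i$ of $\mathcal K_i$ with $T_i^2\cong\mathrm{id}$, acting trivially on $\mathrm{K}_{\mathrm{num}}(\mathcal K_i)$, $i=1,2$. - (C4) $T_1\circ[2]$ is a Serre functor of $\mathcal K_1$ and $[2]$ is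 a Serre functor of $\mathcal K_2$. - (C5) There are exact functors $\Phi^*\colon\mathcal K_2\to\mathcal K_1$ and $\Phi_*\colon\mathcal K_1\to\mathcal K_2$ with adjunctions $\Phi_*\circ T_1\dashv\Phi^*\dashv\Phi_*$, such that $\Phi_*(\lambda_i)=\Lambda_i$ and $\Phi^*(\Lambda_i)=2\lambda_i$ for $i=1,2$, and $\Phi^*T_2(F)\cong T_1(\Phi^*F)$ for all $F\in\mathcal K_2$. - (C6) There are stability conditions $\sigma_i=(Z_i,\mathcal A_i)$ on $\mathcal K_i$, $i=1,2$, such that (a) $\sigma_i$ is $T_i$-invariant; (b) $Z_1(\lambda_1)=Z_2(\Lambda_1)=-1$ and $Z_1(\lambda_2)=Z_2(\Lambda_2)=\sqrt{-1}$; (c) for each $i=1,2$ there are infinitely many pairwise non-isomorphic $\sigma_1$-stable objects of class $\lambda_i$ in the heart $\mathcal A_1$; (d) for every $\sigma_1$-stable $E\in\mathcal K_1$ of class $\lambda_1$ or $\lambda_2$, $\Phi_*E$ is $\sigma_2$-stable of the same phase as $E$. - (C7) Every $E\in\mathcal K_1$ lies in an exact triangle $T_1(E)\to\Phi^*\Phi_*E\to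 E$. - (C8) Every $F\in\mathcal K_2$ lies in an exact triangle $F\to\Phi_*\Phi^*F\to T_2(F)$. Then: 1. An object $E\in\mathcal K_1$ is $\sigma_1$-semistable of phase $\phi$ if and only if $\Phi_*E$ is $\sigma_2$-semistable of phase $\phi$. Moreover, $\Phi_*E$ is $\sigma_2$-stable if and only if $E$ is $\sigma_1$-stable and $\Phi^*F\not\cong E$ for every $\sigma_2$-stable object $F$. 2. An object $F\in\mathcal K_2$ is $\sigma_2$-semistable of phase $\phi$ if and only if $\Phi^*F$ is $\sigma_1$-semistable of phase $\phi$. Moreover, $\Phi^*F$ is $\sigma_1$-stable if and only if $F$ is $\sigma_2$-stable and $\Phi_*E\not\cong F$ for every $\sigma_1$-stable object $E$. -/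

import Mathlib

open CategoryTheory CategoryTheory.Limits CategoryTheory.Pretriangulated
open scoped TensorProduct

universe v u v' u'

noncomputable section

namespace TriStab

/-! ### Euler characteristics of long exact sequences -/

section LinearAlgebra

/-- Additivity of the Euler characteristic along a long exact sequence
`⋯ → A n → B n → D n → A (n + 1) → ⋯` with finitely many nonzero terms. -/
theorem finsum_euler_add {A B D : ℤ → Type v}
    [∀ n, AddCommGroup (A n)] [∀ n, AddCommGroup (B n)] [∀ n, AddCommGroup (D n)]
    [∀ n, Module ℂ (A n)] [∀ n, Module ℂ (B n)] [∀ n, Module ℂ (D n)]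
    [∀ n, Module.Finite ℂ (A n)] [∀ n, Module.Finite ℂ (B n)] [∀ n, Module.Finite ℂ (D n)]
    (hB : {n : ℤ | Module.finrank ℂ (B n) ≠ 0}.Finite)
    (hD : {n : ℤ | Module.finrank ℂ (D n) ≠ 0}.Finite)
    (f : ∀ n, A n →ₗ[ℂ] B n) (g : ∀ n, B n →ₗ[ℂ] D n) (d : ∀ n, D n →ₗ[ℂ] A (n + 1))
    (hfg : ∀ n, Function.Exact (f n) (g n)) (hgd : ∀ n, Function.Exact (g n) (d n))
    (hdf : ∀ n, Function.Exact (d n) (f (n + 1))) :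
    ∑ᶠ n : ℤ, (n.negOnePow : ℤ) * (Module.finrank ℂ (B n) : ℤ) =
      ∑ᶠ n : ℤ, (n.negOnePow : ℤ) * (Module.finrank ℂ (A n) : ℤ) +
        ∑ᶠ n : ℤ, (n.negOnePow : ℤ) * (Module.finrank ℂ (D n) : ℤ) := by
  let r : ℤ → ℕ := fun n => Module.finrank ℂ (LinearMap.range (f n))
  let s : ℤ → ℕ := fun n => Module.finrank ℂ (LinearMap.range (g n))
  let t : ℤ → ℕ := fun n => Module.finrank ℂ (LinearMap.range (d n))
  have hb : ∀ n, Module.finrank ℂ (B n) = r n + s n := by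
    intro n
    have h1 := LinearMap.finrank_range_add_finrank_ker (g n)
    rw [(hfg n).linearMap_ker_eq] at h1
    simp only [r, s]; omega
  have hc : ∀ n, Module.finrank ℂ (D n) = s n + t n := by
    intro n
    have h1 := LinearMap.finrank_range_add_finrank_ker (d n)
    rw [(hgd n).linearMap_ker_eq] at h1
    simp only [s, t]; omega
  have ha' : ∀ n, Module.finrank ℂ (A (n + 1)) = t n + r (n + 1) := by
    intro n
    have h1 := LinearMap.finrank_range_add_finrank_ker (f (n + 1))
    rw [(hdf n).linearMap_ker_eq] at h1
    simp only [r, t]; omega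
  have ha : ∀ n, Module.finrank ℂ (A n) = t (n - 1) + r n := by
    intro n
    have h1 := ha' (n - 1)
    rw [sub_add_cancel] at h1
    exact h1
  have hr : (Function.support fun n : ℤ => (n.negOnePow : ℤ) * (r n : ℤ)).Finite := by
    refine hB.subset fun n hn => ?_
    have h2 : r n ≠ 0 := fun h => hn (by simp [h])
    have := hb n
    simp only [Set.mem_ofPred_eq]; omega
  have hs : (Function.support fun n : ℤ => (n.negOnePow : ℤ) * (s n : ℤ)).Finite := by
    refine hB.subset fun n hn => ?_
    have h2 : s n ≠ 0 := fun h => hn (by simp [h])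
    have := hb n
    simp only [Set.mem_ofPred_eq]; omega
  have ht : (Function.support fun n : ℤ => (n.negOnePow : ℤ) * (t n : ℤ)).Finite := by
    refine hD.subset fun n hn => ?_
    have h2 : t n ≠ 0 := fun h => hn (by simp [h])
    have := hc n
    simp only [Set.mem_ofPred_eq]; omega
  have hshift : ∀ n : ℤ, (n.negOnePow : ℤ) * (t (n - 1) : ℤ) =
      (fun m : ℤ => -((m.negOnePow : ℤ) * (t m : ℤ))) (Equiv.subRight (1 : ℤ) n) := by
    intro n
    simp [Int.negOnePow_sub]
  have ht' : (Function.support fun n : ℤ => (n.negOnePow : ℤ) * (t (n - 1) : ℤ)).Finite := by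
    have h3 := ht.preimage ((Equiv.subRight (1 : ℤ)).injective.injOn)
    refine h3.subset fun n hn => ?_
    simp only [Function.mem_support, hshift] at hn
    simpa using hn
  have e1 : ∑ᶠ n : ℤ, (n.negOnePow : ℤ) * (t (n - 1) : ℤ) =
      - ∑ᶠ n : ℤ, (n.negOnePow : ℤ) * (t n : ℤ) := by
    rw [finsum_congr hshift, ← finsum_neg_distrib]
    exact finsum_comp_equiv (f := fun m : ℤ => -((m.negOnePow : ℤ) * (t m : ℤ)))
      (Equiv.subRight (1 : ℤ))
  simp only [hb, hc, ha, Nat.cast_add, mul_add]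
  rw [finsum_add_distrib hr hs, finsum_add_distrib hs ht, finsum_add_distrib ht' hr, e1]
  ring

end LinearAlgebra

/-! ### Triangulated categories of finite type and the Euler form -/

section Categories

variable (C : Type u) [Category.{v} C] [HasZeroObject C] [HasShift C ℤ] [Preadditive C]
  [∀ n : ℤ, (shiftFunctor C n).Additive] [Pretriangulated C]

/-- The Grothendieck group: generated by objects, with `[X₂] = [X₁] + [X₃]` for each exact triangle
`X₁ ⟶ X₂ ⟶ X₃ ⟶ X₁[1]`. -/
def K0Relations : AddSubgroup (FreeAbelianGroup C) :=
  AddSubgroup.closure {x | ∃ T : Triangle C, T ∈ distTriang C ∧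
    x = FreeAbelianGroup.of T.obj₂ - (FreeAbelianGroup.of T.obj₁ + FreeAbelianGroup.of T.obj₃)}

abbrev K0 : Type u := FreeAbelianGroup C ⧸ K0Relations C

variable {C}

/-- An additive invariant of exact triangles induces a homomorphism from `K0`. -/
def K0.lift {G : Type*} [AddCommGroup G] (f : C → G)
    (hf : ∀ T : Triangle C, T ∈ distTriang C → f T.obj₂ = f T.obj₁ + f T.obj₃) : K0 C →+ G :=
  QuotientAddGroup.lift (K0Relations C) (FreeAbelianGroup.lift f) (by
    refine (AddSubgroup.closure_le _).2 ?_
    rintro _ ⟨T, hT, rfl⟩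
    simp [hf T hT])

/-- The class of an object in the Grothendieck group. -/
def K0.of (E : C) : K0 C := QuotientAddGroup.mk (FreeAbelianGroup.of E)

theorem K0.lift_of {G : Type*} [AddCommGroup G] (f : C → G)
    (hf : ∀ T : Triangle C, T ∈ distTriang C → f T.obj₂ = f T.obj₁ + f T.obj₃) (E : C) :
    K0.lift f hf (K0.of E) = f E :=
  FreeAbelianGroup.lift_apply_of f E

theorem K0.hom_ext {G : Type*} [AddCommGroup G] {f g : K0 C →+ G}
    (h : ∀ E : C, f (K0.of E) = g (K0.of E)) : f = g := by
  refine QuotientAddGroup.addMonoidHom_ext _ (FreeAbelianGroup.lift_ext _ _ fun E => h E)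

variable [Linear ℂ C]

variable (C) in
/-- A `ℂ`-linear triangulated category is of finite type if `∑ᵢ dim Hom(E, F[i])` is finite for
all objects `E`, `F`. -/
class IsFiniteType : Prop where
  finite_hom (E F : C) : Module.Finite ℂ (E ⟶ F)
  finite_support (E F : C) : {n : ℤ | Module.finrank ℂ (E ⟶ F⟦n⟧) ≠ 0}.Finite

attribute [instance] IsFiniteType.finite_hom

/-- The Euler characteristic `χ(E, F) = ∑ₙ (-1)ⁿ dim Hom(E, F[n])`. -/
def chi (E F : C) : ℤ :=
  ∑ᶠ n : ℤ, (n.negOnePow : ℤ) * (Module.finrank ℂ (E ⟶ F⟦n⟧) : ℤ)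

theorem chi_triangle_right [IsFiniteType C] (E : C) (T : Triangle C) (hT : T ∈ distTriang C) :
    chi E T.obj₂ = chi E T.obj₁ + chi E T.obj₃ := by
  have ex1 := fun n : ℤ =>
    (preadditiveCoyoneda.obj (Opposite.op E)).homologySequence_exact₁ T hT n (n + 1) rfl
  have ex2 := fun n : ℤ => (preadditiveCoyoneda.obj (Opposite.op E)).homologySequence_exact₂ T hT n
  have ex3 := fun n : ℤ =>
    (preadditiveCoyoneda.obj (Opposite.op E)).homologySequence_exact₃ T hT n (n + 1) rfl
  simp only [ShortComplex.ab_exact_iff_function_exact] at ex1 ex2 ex3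
  refine finsum_euler_add (A := fun n => (E ⟶ T.obj₁⟦n⟧)) (B := fun n => (E ⟶ T.obj₂⟦n⟧))
    (D := fun n => (E ⟶ T.obj₃⟦n⟧)) (IsFiniteType.finite_support E T.obj₂)
    (IsFiniteType.finite_support E T.obj₃)
    (fun n => Linear.rightComp ℂ E (T.mor₁⟦n⟧')) (fun n => Linear.rightComp ℂ E (T.mor₂⟦n⟧'))
    (fun n => Linear.rightComp ℂ E
      (T.mor₃⟦n⟧' ≫ (shiftFunctorAdd' C 1 n (n + 1) (by lia)).inv.app T.obj₁))
    (fun n => ex2 n) (fun n => ?_) (fun n => ?_)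
  · intro x
    have h := ex3 n x
    erw [preadditiveCoyoneda_homologySequenceδ_apply T n (n + 1) rfl (A := Opposite.op E) x] at h
    exact h
  · intro x
    refine (ex1 n x).trans ?_
    constructor
    · rintro ⟨y, hy⟩
      refine ⟨y, ?_⟩
      rw [← hy]
      exact (preadditiveCoyoneda_homologySequenceδ_apply T n (n + 1) rfl
        (A := Opposite.op E) y).symm
    · rintro ⟨y, hy⟩
      refine ⟨y, ?_⟩
      rw [← hy]
      exact (preadditiveCoyoneda_homologySequenceδ_apply T n (n + 1) rfl
        (A := Opposite.op E) y)

theorem chi_triangle_left [∀ n : ℤ, (shiftFunctor C n).Linear ℂ] [IsFiniteType C]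
    (T : Triangle C) (hT : T ∈ distTriang C) (F : C) :
    chi T.obj₂ F = chi T.obj₁ F + chi T.obj₃ F := by
  rw [add_comm]
  refine finsum_euler_add (A := fun n => (T.obj₃ ⟶ F⟦n⟧)) (B := fun n => (T.obj₂ ⟶ F⟦n⟧))
    (D := fun n => (T.obj₁ ⟶ F⟦n⟧)) (IsFiniteType.finite_support T.obj₂ F)
    (IsFiniteType.finite_support T.obj₁ F)
    (fun n => Linear.leftComp ℂ _ T.mor₂) (fun n => Linear.leftComp ℂ _ T.mor₁)
    (fun n => (Linear.leftComp ℂ _ T.mor₃).comp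
      ((Linear.rightComp ℂ _ ((shiftFunctorAdd' C n 1 (n + 1) rfl).inv.app F)).comp
        ((shiftFunctor C (1 : ℤ)).mapLinearMap ℂ)))
    (fun n => ?_) (fun n => ?_) (fun n => ?_)
  · intro x
    constructor
    · intro hx
      obtain ⟨y, hy⟩ := T.yoneda_exact₂ hT x hx
      exact ⟨y, hy.symm⟩
    · rintro ⟨y, rfl⟩
      change T.mor₁ ≫ T.mor₂ ≫ y = 0
      rw [← Category.assoc, comp_distTriang_mor_zero₁₂ _ hT, zero_comp]
  · intro x
    constructor
    · intro hx
      have hx' : T.mor₃ ≫ x⟦(1 : ℤ)⟧' = 0 := by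
        change T.mor₃ ≫ x⟦(1 : ℤ)⟧' ≫ (shiftFunctorAdd' C n 1 (n + 1) rfl).inv.app F = 0 at hx
        rw [← cancel_mono ((shiftFunctorAdd' C n 1 (n + 1) rfl).inv.app F), Category.assoc, hx,
          zero_comp]
      have key : ∃ y : T.obj₂⟦(1 : ℤ)⟧ ⟶ (F⟦n⟧)⟦(1 : ℤ)⟧,
          x⟦(1 : ℤ)⟧' = (-T.mor₁⟦(1 : ℤ)⟧') ≫ y :=
        T.rotate.yoneda_exact₃ (rot_of_distTriang _ hT) (x⟦(1 : ℤ)⟧') hx'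
      obtain ⟨y, hy⟩ := key
      obtain ⟨z, rfl⟩ := (shiftFunctor C (1 : ℤ)).map_surjective y
      refine ⟨-z, (shiftFunctor C (1 : ℤ)).map_injective ?_⟩
      change (shiftFunctor C (1 : ℤ)).map (T.mor₁ ≫ (-z)) = _
      rw [hy, Functor.map_comp, Functor.map_neg, Preadditive.comp_neg, Preadditive.neg_comp]
    · rintro ⟨y, rfl⟩
      change T.mor₃ ≫ (shiftFunctor C (1 : ℤ)).map (T.mor₁ ≫ y) ≫
        (shiftFunctorAdd' C n 1 (n + 1) rfl).inv.app F = 0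
      rw [Functor.map_comp, Category.assoc, ← Category.assoc,
        comp_distTriang_mor_zero₃₁ _ hT, zero_comp]
  · intro x
    constructor
    · intro hx
      obtain ⟨y, hy⟩ := T.yoneda_exact₃ hT x hx
      obtain ⟨z, hz⟩ := (shiftFunctor C (1 : ℤ)).map_surjective
        (y ≫ (shiftFunctorAdd' C n 1 (n + 1) rfl).hom.app F)
      refine ⟨z, ?_⟩
      change T.mor₃ ≫ (shiftFunctor C (1 : ℤ)).map z ≫
        (shiftFunctorAdd' C n 1 (n + 1) rfl).inv.app F = x
      rw [hz, Category.assoc, Iso.hom_inv_id_app, hy]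
      erw [Category.comp_id]
    · rintro ⟨y, rfl⟩
      change T.mor₂ ≫ T.mor₃ ≫ _ = 0
      rw [← Category.assoc, comp_distTriang_mor_zero₂₃ _ hT, zero_comp]

variable [∀ n : ℤ, (shiftFunctor C n).Linear ℂ] [IsFiniteType C]

variable (C) in
/-- The Euler form on the Grothendieck group. -/
def eulerK0 : K0 C →+ K0 C →+ ℤ :=
  K0.lift (fun E => K0.lift (fun F => chi E F) (chi_triangle_right E)) (fun T hT =>
    K0.hom_ext fun F => by
      rw [AddMonoidHom.add_apply, K0.lift_of, K0.lift_of, K0.lift_of, chi_triangle_left T hT F])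

theorem eulerK0_of (E F : C) : eulerK0 C (K0.of E) (K0.of F) = chi E F := by
  rw [eulerK0, K0.lift_of, K0.lift_of]

variable (C) in
/-- The kernel of the Euler form: classes `x` with `χ(x, -) = 0` and `χ(-, x) = 0`.
(If there is a Serre functor, each of the two conditions implies the other.) -/
def eulerKer : AddSubgroup (K0 C) :=
  (eulerK0 C).ker ⊓ (eulerK0 C).flip.ker

variable (C) in
/-- The numerical Grothendieck group `K(C) / ker χ`. -/
abbrev KNum : Type u := K0 C ⧸ eulerKer C

/-- The class of an object in the numerical Grothendieck group. -/
def cls (E : C) : KNum C := QuotientAddGroup.mk (K0.of E)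

variable (C) in
/-- The Euler pairing on the numerical Grothendieck group. -/
def euler : KNum C →+ KNum C →+ ℤ :=
  QuotientAddGroup.lift (eulerKer C)
    ((QuotientAddGroup.lift (eulerKer C) (eulerK0 C).flip (fun _ hx => hx.2)).flip) (by
      intro x hx
      ext y
      exact DFunLike.congr_fun (show eulerK0 C x = 0 from hx.1) _)

theorem euler_cls (E F : C) : euler C (cls E) (cls F) = chi E F :=
  eulerK0_of E F

/-! ### Serre functors -/

/-- `S` is a Serre functor: an equivalence with isomorphisms `Hom(E, F) ≅ Hom(F, S E)^∨`, natural
in `E` and `F`. -/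
def IsSerreFunctor (S : C ⥤ C) : Prop :=
  S.IsEquivalence ∧
    ∃ η : ∀ E F : C, (E ⟶ F) ≃ₗ[ℂ] Module.Dual ℂ (F ⟶ S.obj E),
      ∀ (E E' F F' : C) (a : E' ⟶ E) (b : F ⟶ F') (f : E ⟶ F) (g : F' ⟶ S.obj E'),
        η E' F' (a ≫ f ≫ b) g = η E F f (b ≫ g ≫ S.map a)

/-! ### Stability conditions -/

variable (C) in
/-- A bounded t-structure together with a homomorphism `Z` from the numerical Grothendieck group
to `ℂ` which is a stability function on the heart. -/
structure HeartWithStabilityFunction where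
  t : Triangulated.TStructure C
  bounded : t.bounded = ⊤
  Z : KNum C →+ ℂ
  upper_half_plane : ∀ E : C, t.heart E → ¬ IsZero E →
    0 < (Z (cls E)).im ∨ ((Z (cls E)).im = 0 ∧ (Z (cls E)).re < 0)

namespace HeartWithStabilityFunction

variable (σ : HeartWithStabilityFunction C)

/-- The slope `μ(E) = - Re Z(E) / Im Z(E)`, equal to `+∞` if `Im Z(E) = 0`. -/
def slope (E : C) : EReal :=
  open Classical in
  if 0 < (σ.Z (cls E)).im then ((-(σ.Z (cls E)).re / (σ.Z (cls E)).im : ℝ) : EReal) else ⊤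

/-- `E` is a nonzero object of the heart with `μ(A) ≤ μ(E)` for every nonzero proper subobject `A`
of `E` in the heart. Short exact sequences `0 → A → E → B → 0` in the heart are the same as exact
triangles `A → E → B → A[1]` with all three objects in the heart. -/
def HeartSemistable (E : C) : Prop :=
  σ.t.heart E ∧ ¬ IsZero E ∧
    ∀ T : Triangle C, T ∈ distTriang C → T.obj₂ = E → σ.t.heart T.obj₁ → σ.t.heart T.obj₃ →
      ¬ IsZero T.obj₁ → ¬ IsZero T.obj₃ → σ.slope T.obj₁ ≤ σ.slope E

/-- `E` is a nonzero object of the heart with `μ(A) < μ(E)` for every nonzero proper subobject `A`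
of `E` in the heart. -/
def HeartStable (E : C) : Prop :=
  σ.t.heart E ∧ ¬ IsZero E ∧
    ∀ T : Triangle C, T ∈ distTriang C → T.obj₂ = E → σ.t.heart T.obj₁ → σ.t.heart T.obj₃ →
      ¬ IsZero T.obj₁ → ¬ IsZero T.obj₃ → σ.slope T.obj₁ < σ.slope E

/-- A Harder–Narasimhan filtration `0 = X₀ ⊂ X₁ ⊂ ⋯ ⊂ Xₙ = E` in the heart, with semistable
quotients `Gᵢ = Xᵢ₊₁ / Xᵢ` of strictly decreasing slopes. -/
structure HNFiltration (E : C) where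
  n : ℕ
  X : Fin (n + 1) → C
  G : Fin n → C
  i : ∀ k : Fin n, X k.castSucc ⟶ X k.succ
  p : ∀ k : Fin n, X k.succ ⟶ G k
  δ : ∀ k : Fin n, G k ⟶ (X k.castSucc)⟦(1 : ℤ)⟧
  heart_X : ∀ k, σ.t.heart (X k)
  distinguished : ∀ k, Triangle.mk (i k) (p k) (δ k) ∈ distTriang C
  semistable : ∀ k, σ.HeartSemistable (G k)
  slope_strictAnti : StrictAnti fun k => σ.slope (G k)
  zero : IsZero (X 0)
  top : X (Fin.last n) ≅ E

/-- The phase `(1/π) arg Z(E) ∈ (0, 1]` of a nonzero object of the heart. -/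
def heartPhase (E : C) : ℝ := (σ.Z (cls E)).arg / Real.pi

end HeartWithStabilityFunction

variable (C) in
/-- A (Bridgeland) stability condition `(𝒜, Z)` with `Z` factoring through the numerical
Grothendieck group, which has to be of finite rank. -/
structure StabilityCondition extends HeartWithStabilityFunction C where
  finite_rank : Module.Finite ℤ (KNum C)
  exists_HN : ∀ E : C, t.heart E →
    Nonempty (toHeartWithStabilityFunction.HNFiltration E)
  /-- The support property. -/
  support : ∃ Q : QuadraticForm ℝ (ℝ ⊗[ℤ] KNum C),
    (∀ x : ℝ ⊗[ℤ] KNum C, LinearMap.liftBaseChange ℝ Z.toIntLinearMap x = 0 → x ≠ 0 → Q x < 0) ∧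
    ∀ E : C, toHeartWithStabilityFunction.HeartSemistable E → 0 ≤ Q (1 ⊗ₜ[ℤ] cls E)

namespace StabilityCondition

variable (σ : StabilityCondition C)

/-- `E` is `σ`-semistable of phase `φ`: it is a shift `A[n]` of a semistable object `A` of the
heart, and `φ = φ(A) + n`. -/
def IsSemistableOfPhase (E : C) (φ : ℝ) : Prop :=
  ∃ (A : C) (n : ℤ), σ.HeartSemistable A ∧ Nonempty (E ≅ A⟦n⟧) ∧ φ = σ.heartPhase A + n

/-- `E` is `σ`-stable of phase `φ`. -/
def IsStableOfPhase (E : C) (φ : ℝ) : Prop :=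
  ∃ (A : C) (n : ℤ), σ.HeartStable A ∧ Nonempty (E ≅ A⟦n⟧) ∧ φ = σ.heartPhase A + n

/-- `E` is `σ`-stable. -/
def IsStable (E : C) : Prop := ∃ φ : ℝ, σ.IsStableOfPhase E φ

end StabilityCondition

/-- An element of the universal cover of `GL⁺(2, ℝ)`: a pair `(M, f)` of an orientation preserving
linear automorphism `M` of `ℂ = ℝ²` and an increasing bijection `f` of `ℝ` with
`f (x + 1) = f x + 1`, inducing the same map on the circle of rays `(ℂ ∖ 0) / ℝ_{>0} = ℝ / 2ℤ`. -/
structure GLTilde where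
  M : ℂ ≃ₗ[ℝ] ℂ
  det_pos : 0 < LinearMap.det (M : ℂ →ₗ[ℝ] ℂ)
  f : ℝ ≃o ℝ
  f_add_one : ∀ x, f (x + 1) = f x + 1
  compat : ∀ x : ℝ, ∃ r : ℝ, 0 < r ∧
    M (Complex.exp (Real.pi * x * Complex.I)) = r * Complex.exp (Real.pi * f x * Complex.I)

/-- `σ` is invariant under the auto-equivalence `T`: there is `g = (M, f)` in the universal cover
of `GL⁺(2, ℝ)` with `T · σ = σ · g`. Here `T · σ` has central charge `Z ∘ T_*⁻¹` and slicing
`T(P(x))`, while `σ · g` has central charge `M⁻¹ ∘ Z` and slicing `P(f x)`. -/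
def IsInvariant (σ : StabilityCondition C) (T : C ⥤ C) : Prop :=
  ∃ g : GLTilde, (∀ E : C, σ.Z (cls E) = g.M.symm (σ.Z (cls (T.obj E)))) ∧
    ∀ (E : C) (x : ℝ), σ.IsSemistableOfPhase E x ↔ σ.IsSemistableOfPhase (T.obj E) (g.f x)

end Categories

section Functors

variable {C : Type u} [Category.{v} C] [HasZeroObject C] [HasShift C ℤ] [Preadditive C]
  [∀ n : ℤ, (shiftFunctor C n).Additive] [Pretriangulated C] [Linear ℂ C]
  [∀ n : ℤ, (shiftFunctor C n).Linear ℂ] [IsFiniteType C]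
  {D : Type u'} [Category.{v'} D] [HasZeroObject D] [HasShift D ℤ] [Preadditive D]
  [∀ n : ℤ, (shiftFunctor D n).Additive] [Pretriangulated D] [Linear ℂ D]
  [∀ n : ℤ, (shiftFunctor D n).Linear ℂ] [IsFiniteType D]

/-- `f` is the homomorphism of numerical Grothendieck groups induced by the functor `Φ`. -/
def IsInducedMap (Φ : C ⥤ D) (f : KNum C →+ KNum D) : Prop :=
  ∀ E : C, f (cls E) = cls (Φ.obj E)

end Functors

end TriStab

end

open TriStab

/-! Everything is reduced to a comparison of hearts. Pushing forward multiplies central charges by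
`1`, pulling back by `2`, and the involutions by `1`. Once both functors are t-exact, each reflects
semistability and stability, since it maps short exact sequences of hearts to such and preserves the
sign of slope comparisons.

T-exactness starts from the involutions: invariance, with trivial action on numerical classes,
forces them to preserve hearts (`preservesHeart_of_isInvariant`). The triangle over `E` then puts
`pull (push E)` in the heart for `E` in the heart. Take stable `A i` of class `l i`; by adjunction
and Serre duality, `push (A i)` has no morphisms to `push E` in degrees below `0` or above `2`. So a
cohomology object of `push E` in a degree outside `[-1, 1]` receives no degree one morphism from
`push (A i)`; negativity of the Euler form then makes its charge incompatible with the upper half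
plane, and it vanishes (`amplitude_of_hom_eq_zero`). Cohomology in degrees `1` and `-1` vanishes
because `pull` would move it by one step into the heart and reverse the sign of a positive multiple
of its charge (`preservesHeart_of_amplitude`). Exactness of `pull` follows from its two adjunctions
with `push`.

Semistability of `push E` follows because `pull (push E)` is an extension of `E` by `T₁ E`, two
semistable objects of equal charge, and `pull` reflects semistability; the same works for the other
composite. If `E` is stable but its image under one of the functors is not, a subobject `A` and
quotient `B` of the image of equal slope give, by adjunction, a surjection onto `E` and an injection
from `E`. Since the two scaling factors have product `2`, the charges leave no room for kernel or
cokernel, and `E` is the image of `A` (`exists_heartStable_of_not_heartStable`). -/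

namespace TriStab

/-! ### Shifts and functors commuting with them. -/

section Shifts

variable {C : Type u} [Category.{v} C] [HasShift C ℤ] {D : Type u'} [Category.{v'} D] [HasShift D ℤ]

/-- The compatibility of a functor with shifts, on an object. -/
noncomputable def shiftObjIso (F : C ⥤ D) [F.CommShift ℤ] (X : C) (n : ℤ) :
    F.obj (X⟦n⟧) ≅ (F.obj X)⟦n⟧ :=
  (F.commShiftIso n).app X

theorem nonempty_iso_of_shift_iso {X Y : C} {n : ℤ} (e : X⟦n⟧ ≅ Y⟦n⟧) : Nonempty (X ≅ Y) :=
  ⟨(shiftFunctor C n).preimageIso e⟩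

theorem nonempty_shift_neg_iso {X Y : C} {n : ℤ} (e : X ≅ Y⟦n⟧) : Nonempty (X⟦-n⟧ ≅ Y) :=
  ⟨(shiftFunctor C (-n)).mapIso e ≪≫ ((shiftEquiv C n).unitIso.app Y).symm⟩

theorem nonempty_iso_shift_of_neg {X Y : C} {n : ℤ} (e : X⟦-n⟧ ≅ Y) : Nonempty (X ≅ Y⟦n⟧) :=
  ⟨((shiftEquiv C n).counitIso.app X).symm ≪≫ (shiftFunctor C n).mapIso e⟩

end Shifts

/-! ### Hearts of t-structures: monomorphisms, epimorphisms and images. -/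

section TStructures

variable {C : Type u} [Category.{v} C] [HasZeroObject C] [HasShift C ℤ] [Preadditive C]
  [∀ n : ℤ, (shiftFunctor C n).Additive] [Pretriangulated C]
  (t : Triangulated.TStructure C)

theorem heart_iff {X : C} : t.heart X ↔ t.IsLE X 0 ∧ t.IsGE X 0 := t.mem_heart_iff X

variable {t}

theorem heart_of_triangle {X Y Z : C} {f : X ⟶ Y} {g : Y ⟶ Z} {h : Z ⟶ X⟦(1 : ℤ)⟧}
    (hT : Triangle.mk f g h ∈ distTriang C) (hX : t.heart X) (hZ : t.heart Z) : t.heart Y := by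
  rw [heart_iff] at *
  exact ⟨t.isLE₂ _ hT 0 hX.1 hZ.1, t.isGE₂ _ hT 0 hX.2 hZ.2⟩

theorem isLE₃_of_triangle {X Y Z : C} {f : X ⟶ Y} {g : Y ⟶ Z} {h : Z ⟶ X⟦(1 : ℤ)⟧}
    (hT : Triangle.mk f g h ∈ distTriang C) (n : ℤ) (hX : t.IsLE X (n + 1)) (hY : t.IsLE Y n) :
    t.IsLE Z n :=
  t.isLE₂ _ (rot_of_distTriang _ hT) n hY (t.isLE_shift X (n + 1) 1 n)

theorem isGE₁_of_triangle {X Y Z : C} {f : X ⟶ Y} {g : Y ⟶ Z} {h : Z ⟶ X⟦(1 : ℤ)⟧}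
    (hT : Triangle.mk f g h ∈ distTriang C) (n : ℤ) (hY : t.IsGE Y n) (hZ : t.IsGE Z (n - 1)) :
    t.IsGE X n :=
  t.isGE₂ _ (inv_rot_of_distTriang _ hT) n (t.isGE_shift Z (n - 1) (-1) n) hY

theorem heart_of_isZero {X : C} (hX : IsZero X) : t.heart X :=
  (heart_iff t).2 ⟨t.isLE_of_isZero hX 0, t.isGE_of_isZero hX 0⟩

theorem heart_of_iso {X Y : C} (e : X ≅ Y) (hX : t.heart X) : t.heart Y :=
  t.heart.prop_of_iso e hX

theorem hom_shift_eq_zero_of_heart {X Y : C} (hX : t.heart X) (hY : t.heart Y) {n : ℤ} (hn : n < 0)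
    (f : X ⟶ Y⟦n⟧) : f = 0 := by
  rw [heart_iff] at hX hY
  obtain ⟨_, _⟩ := hX
  obtain ⟨_, _⟩ := hY
  have := t.isGE_shift Y 0 n (-n)
  exact t.zero f 0 (-n)

/-- Shifts of two nonzero objects of the heart can only be isomorphic if the shifts agree. -/
theorem shift_eq_of_heart {X Y : C} (hX : t.heart X) (hY : t.heart Y) (hX0 : ¬ IsZero X) {n m : ℤ}
    (e : X⟦n⟧ ≅ Y⟦m⟧) : n = m := by
  rw [heart_iff] at hX hY
  obtain ⟨_, _⟩ := hX
  obtain ⟨_, _⟩ := hY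
  have := t.isLE_shift X 0 n (-n)
  have := t.isGE_shift X 0 n (-n)
  have := t.isLE_shift Y 0 m (-m)
  have := t.isGE_shift Y 0 m (-m)
  have := t.isLE_of_iso e.symm (-m)
  have := t.isGE_of_iso e.symm (-m)
  by_contra hnm
  apply hX0
  have h0 : IsZero (X⟦n⟧) := by
    rcases lt_or_gt_of_ne hnm with h | h
    · exact t.isZero (X⟦n⟧) (-m) (-n)
    · exact t.isZero (X⟦n⟧) (-n) (-m)
  exact ((shiftFunctor C (-n)).map_isZero h0).of_iso ((shiftEquiv C n).unitIso.app X)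

variable (t) in
/-- A morphism whose kernel in the heart vanishes. -/
def HeartMono {X Y : C} (f : X ⟶ Y) : Prop :=
  ∀ ⦃K : C⦄ (k : K ⟶ X), t.heart K → k ≫ f = 0 → k = 0

variable (t) in
/-- A morphism whose cokernel in the heart vanishes. -/
def HeartEpi {X Y : C} (f : X ⟶ Y) : Prop :=
  ∀ ⦃Q : C⦄ (q : Y ⟶ Q), t.heart Q → f ≫ q = 0 → q = 0

theorem heartMono_of_triangle {X Y Z : C} {f : X ⟶ Y} {g : Y ⟶ Z} {h : Z ⟶ X⟦(1 : ℤ)⟧}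
    (hT : Triangle.mk f g h ∈ distTriang C) (hZ : t.heart Z) : HeartMono t f := by
  intro K k hK hk
  obtain ⟨y, hy⟩ := (Triangle.mk f g h).invRotate.coyoneda_exact₂ (inv_rot_of_distTriang _ hT) k hk
  have hy0 : y = 0 := hom_shift_eq_zero_of_heart hK hZ (by norm_num : (-1 : ℤ) < 0) y
  subst hy0
  exact hy.trans zero_comp

theorem heartEpi_of_triangle {X Y Z : C} {f : X ⟶ Y} {g : Y ⟶ Z} {h : Z ⟶ X⟦(1 : ℤ)⟧}
    (hT : Triangle.mk f g h ∈ distTriang C) (hX : t.heart X) : HeartEpi t g := by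
  intro Q q hQ hq
  obtain ⟨y, hy⟩ := (Triangle.mk f g h).yoneda_exact₃ hT q hq
  have hy0 : y = 0 := by
    rw [heart_iff] at hX hQ
    obtain ⟨_, _⟩ := hX
    obtain ⟨_, _⟩ := hQ
    have := t.isLE_shift X 0 1 (-1)
    exact t.zero (X := X⟦(1 : ℤ)⟧) y (-1) 0
  subst hy0
  exact hy.trans comp_zero

theorem HeartMono.comp {X Y Z : C} {f : X ⟶ Y} {g : Y ⟶ Z} (hf : HeartMono t f)
    (hg : HeartMono t g) : HeartMono t (f ≫ g) := fun K k hK hk =>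
  hf k hK (hg (k ≫ f) hK (by rw [Category.assoc, hk]))

theorem HeartEpi.comp {X Y Z : C} {f : X ⟶ Y} {g : Y ⟶ Z} (hf : HeartEpi t f)
    (hg : HeartEpi t g) : HeartEpi t (f ≫ g) := fun Q q hQ hq =>
  hg q hQ (hf (g ≫ q) hQ (by rw [← Category.assoc, hq]))

theorem HeartMono.ne_zero {X Y : C} {f : X ⟶ Y} (hf : HeartMono t f) (hX : t.heart X)
    (hX0 : ¬ IsZero X) : f ≠ 0 := by
  rintro rfl
  exact hX0 ((IsZero.iff_id_eq_zero X).2 (hf _ hX comp_zero))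

theorem HeartEpi.ne_zero {X Y : C} {f : X ⟶ Y} (hf : HeartEpi t f) (hY : t.heart Y)
    (hY0 : ¬ IsZero Y) : f ≠ 0 := by
  rintro rfl
  exact hY0 ((IsZero.iff_id_eq_zero Y).2 (hf _ hY zero_comp))

/-- Every morphism of the heart has a kernel, an image and a cokernel in the heart. -/
theorem exists_heart_image [IsTriangulated C] {X Y : C} (f : X ⟶ Y) (hX : t.heart X)
    (hY : t.heart Y) :
    ∃ (K I Q : C) (k : K ⟶ X) (p : X ⟶ I) (d : I ⟶ K⟦(1 : ℤ)⟧) (i : I ⟶ Y) (q : Y ⟶ Q)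
      (e : Q ⟶ I⟦(1 : ℤ)⟧), t.heart K ∧ t.heart I ∧ t.heart Q ∧
      Triangle.mk k p d ∈ distTriang C ∧ Triangle.mk i q e ∈ distTriang C ∧ p ≫ i = f := by
  rw [heart_iff] at hX hY
  obtain ⟨_, _⟩ := hX
  obtain ⟨_, _⟩ := hY
  obtain ⟨Z, g, h, hT⟩ := distinguished_cocone_triangle f
  have hZle : t.IsLE Z 0 :=
    isLE₃_of_triangle hT 0 (t.isLE_of_le X 0 (0 + 1)) inferInstance
  have hZge : t.IsGE Z (-1) :=
    t.isGE₂ _ (rot_of_distTriang _ hT) (-1) (t.isGE_of_ge Y (-1) 0) (t.isGE_shift X 0 1 (-1))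
  have hQ := t.triangleLTGE_distinguished 0 Z
  have hQge : t.IsGE ((t.truncGE 0).obj Z) 0 := inferInstance
  have hQle : t.IsLE ((t.truncGE 0).obj Z) 0 := inferInstance
  have hAge : t.IsGE ((t.truncLT 0).obj Z) (-1) := inferInstance
  have hAle : t.IsLE ((t.truncLT 0).obj Z) (-1) := t.isLE_truncLT_obj ..
  -- The cone `Z` lives in degrees `-1` and `0`. Its degree `0` part is the cokernel, so the image
  -- is the fibre of `Y → H⁰(Z)`; the octahedron identifies the cone of `X → I` with the degree `-1`
  -- part, which is the kernel shifted by one.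
  obtain ⟨I, i, e, hI⟩ := distinguished_cocone_triangle₁ (g ≫ (t.truncGEπ 0).app Z)
  let o := Triangulated.someOctahedron' rfl hT hQ hI
  have hIle : t.IsLE I 0 := t.isLE₂ _ o.mem 0 ‹t.IsLE X 0›
    (t.isLE_of_le ((t.truncLT 0).obj Z) (-1) 0)
  have hIge : t.IsGE I 0 := isGE₁_of_triangle hI 0 inferInstance (t.isGE_of_ge _ (0 - 1) 0)
  obtain ⟨K, k, d, hK⟩ := distinguished_cocone_triangle₁ o.m₁
  have hKA : Nonempty (K⟦(1 : ℤ)⟧ ≅ (t.truncLT 0).obj Z) :=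
    ⟨Triangle.π₃.mapIso (isoTriangleOfIso₁₂ _ _ (rot_of_distTriang _ hK) o.mem (Iso.refl _)
      (Iso.refl _) (by exact (Category.comp_id _).trans (Category.id_comp _).symm))⟩
  obtain ⟨eKA⟩ := hKA
  have h1 : t.IsLE (K⟦(1 : ℤ)⟧) (-1) := t.isLE_of_iso eKA.symm (-1)
  have h2 : t.IsGE (K⟦(1 : ℤ)⟧) (-1) := t.isGE_of_iso eKA.symm (-1)
  exact ⟨K, I, _, k, o.m₁, d, i, _, e, (heart_iff t).2 ⟨t.isLE_of_shift K 0 1 (-1),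
    t.isGE_of_shift K 0 1 (-1)⟩, (heart_iff t).2 ⟨hIle, hIge⟩, (heart_iff t).2 ⟨hQle, hQge⟩, hK, hI,
    o.comm₁⟩

theorem exists_isGE_of_bounded (hb : t.bounded = ⊤) (X : C) : ∃ n : ℤ, t.IsGE X n :=
  (show t.bounded X by rw [hb]; trivial).1

theorem exists_isLE_of_bounded (hb : t.bounded = ⊤) (X : C) : ∃ n : ℤ, t.IsLE X n :=
  (show t.bounded X by rw [hb]; trivial).2

end TStructures

/-! ### T-exactness of functors and adjunctions. -/

section Functors

variable {C : Type u} [Category.{v} C] [HasZeroObject C] [HasShift C ℤ] [Preadditive C]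
  [∀ n : ℤ, (shiftFunctor C n).Additive] [Pretriangulated C]
  {D : Type u'} [Category.{v'} D] [HasZeroObject D] [HasShift D ℤ] [Preadditive D]
  [∀ n : ℤ, (shiftFunctor D n).Additive] [Pretriangulated D]
  (t : Triangulated.TStructure C) (t' : Triangulated.TStructure D)

theorem Functor.map_mk_distinguished (F : C ⥤ D) [F.CommShift ℤ] [F.IsTriangulated] {X Y Z : C}
    {f : X ⟶ Y} {g : Y ⟶ Z} {h : Z ⟶ X⟦(1 : ℤ)⟧} (hT : Triangle.mk f g h ∈ distTriang C) :
    Triangle.mk (F.map f) (F.map g) (F.map h ≫ (F.commShiftIso (1 : ℤ)).hom.app X) ∈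
      distTriang D :=
  F.map_distinguished _ hT

/-- The functor sends objects `≤ n` to objects `≤ n + k`. -/
def BoundedLE (F : C ⥤ D) (k : ℤ) : Prop :=
  ∀ (X : C) (n : ℤ), t.IsLE X n → t'.IsLE (F.obj X) (n + k)

/-- The functor sends objects `≥ n` to objects `≥ n + k`. -/
def BoundedGE (F : C ⥤ D) (k : ℤ) : Prop :=
  ∀ (X : C) (n : ℤ), t.IsGE X n → t'.IsGE (F.obj X) (n + k)

/-- The functor maps the heart to the heart. -/
def PreservesHeart (F : C ⥤ D) : Prop := ∀ X : C, t.heart X → t'.heart (F.obj X)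

variable {t t'}

theorem boundedLE_of_isLE_zero (F : C ⥤ D) [F.CommShift ℤ] {k : ℤ}
    (h : ∀ X, t.IsLE X 0 → t'.IsLE (F.obj X) k) : BoundedLE t t' F k := by
  intro X n hX
  have : t'.IsLE (F.obj (X⟦n⟧)) k := h _ (t.isLE_shift X n n 0)
  have : t'.IsLE ((F.obj X)⟦n⟧) k := t'.isLE_of_iso (shiftObjIso F X n) k
  exact t'.isLE_of_shift (F.obj X) (n + k) n k

theorem boundedGE_of_isGE_zero (F : C ⥤ D) [F.CommShift ℤ] {k : ℤ}
    (h : ∀ X, t.IsGE X 0 → t'.IsGE (F.obj X) k) : BoundedGE t t' F k := by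
  intro X n hX
  have : t'.IsGE (F.obj (X⟦n⟧)) k := h _ (t.isGE_shift X n n 0)
  have : t'.IsGE ((F.obj X)⟦n⟧) k := t'.isGE_of_iso (shiftObjIso F X n) k
  exact t'.isGE_of_shift (F.obj X) (n + k) n k

/-- Bounded objects are iterated extensions of shifts of heart objects; the induction on the length
`m` splits off the degree zero cohomology and shifts the rest back by one. -/
theorem boundedLE_of_heart [IsTriangulated C] (hb : t.bounded = ⊤) (F : C ⥤ D) [F.CommShift ℤ]
    [F.IsTriangulated] {k : ℤ} (h : ∀ X, t.heart X → t'.IsLE (F.obj X) k) :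
    BoundedLE t t' F k := by
  have key : ∀ (m : ℕ) (X : C), t.IsLE X 0 → t.IsGE X (-m) → t'.IsLE (F.obj X) k := by
    intro m
    induction m with
    | zero =>
      intro X h0 h1
      exact h X ((heart_iff t).2 ⟨h0, by simpa using h1⟩)
    | succ m ih =>
      intro X h0 h1
      have hT := F.map_distinguished _ (t.triangleLTGE_distinguished 0 X)
      refine t'.isLE₂ _ hT k ?_ ?_
      · have : t.IsLE ((t.truncLT 0).obj X) (-1) := t.isLE_truncLT_obj ..
        have : t.IsGE ((t.truncLT 0).obj X) (-(m + 1 : ℕ) : ℤ) := inferInstance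
        have := ih (((t.truncLT 0).obj X)⟦(-1 : ℤ)⟧) (t.isLE_shift _ (-1) (-1) 0)
          (t.isGE_shift _ (-(m + 1 : ℕ) : ℤ) (-1) _ (by push_cast; ring))
        have : t'.IsLE ((F.obj ((t.truncLT 0).obj X))⟦(-1 : ℤ)⟧) k :=
          t'.isLE_of_iso (shiftObjIso F _ _) k
        have := t'.isLE_of_shift (F.obj ((t.truncLT 0).obj X)) (k - 1) (-1) k
        exact t'.isLE_of_le (F.obj ((t.truncLT 0).obj X)) (k - 1) k
      · exact h _ ((heart_iff t).2 ⟨(inferInstance : t.IsLE ((t.truncGE 0).obj X) 0),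
          (inferInstance : t.IsGE ((t.truncGE 0).obj X) 0)⟩)
  refine boundedLE_of_isLE_zero F fun X hX => ?_
  obtain ⟨n, hn⟩ := exists_isGE_of_bounded hb X
  exact key n.natAbs X hX (t.isGE_of_ge X _ n)

theorem boundedGE_of_heart [IsTriangulated C] (hb : t.bounded = ⊤) (F : C ⥤ D) [F.CommShift ℤ]
    [F.IsTriangulated] {k : ℤ} (h : ∀ X, t.heart X → t'.IsGE (F.obj X) k) :
    BoundedGE t t' F k := by
  have key : ∀ (m : ℕ) (X : C), t.IsGE X 0 → t.IsLE X m → t'.IsGE (F.obj X) k := by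
    intro m
    induction m with
    | zero =>
      intro X h0 h1
      exact h X ((heart_iff t).2 ⟨by simpa using h1, h0⟩)
    | succ m ih =>
      intro X h0 h1
      have hT := F.map_distinguished _ (t.triangleLTGE_distinguished 1 X)
      refine t'.isGE₂ _ hT k ?_ ?_
      · exact h _ ((heart_iff t).2 ⟨(t.isLE_truncLT_obj .. : t.IsLE ((t.truncLT 1).obj X) 0),
          (inferInstance : t.IsGE ((t.truncLT 1).obj X) 0)⟩)
      · have : t.IsGE ((t.truncGE 1).obj X) 1 := inferInstance
        have : t.IsLE ((t.truncGE 1).obj X) ((m + 1 : ℕ) : ℤ) := inferInstance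
        have := ih (((t.truncGE 1).obj X)⟦(1 : ℤ)⟧) (t.isGE_shift _ 1 1 0)
          (t.isLE_shift _ ((m + 1 : ℕ) : ℤ) 1 _ (by push_cast; ring))
        have : t'.IsGE ((F.obj ((t.truncGE 1).obj X))⟦(1 : ℤ)⟧) k :=
          t'.isGE_of_iso (shiftObjIso F _ _) k
        have := t'.isGE_of_shift (F.obj ((t.truncGE 1).obj X)) (k + 1) 1 k
        exact t'.isGE_of_ge (F.obj ((t.truncGE 1).obj X)) k (k + 1)
  refine boundedGE_of_isGE_zero F fun X hX => ?_
  obtain ⟨n, hn⟩ := exists_isLE_of_bounded hb X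
  exact key n.natAbs X hX (t.isLE_of_le X n _)

theorem PreservesHeart.boundedLE [IsTriangulated C] (hb : t.bounded = ⊤) {F : C ⥤ D}
    [F.CommShift ℤ] [F.IsTriangulated] (h : PreservesHeart t t' F) : BoundedLE t t' F 0 :=
  boundedLE_of_heart hb F fun X hX => ((heart_iff t').1 (h X hX)).1

theorem PreservesHeart.boundedGE [IsTriangulated C] (hb : t.bounded = ⊤) {F : C ⥤ D}
    [F.CommShift ℤ] [F.IsTriangulated] (h : PreservesHeart t t' F) : BoundedGE t t' F 0 :=
  boundedGE_of_heart hb F fun X hX => ((heart_iff t').1 (h X hX)).2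

theorem preservesHeart_of_bounded {F : C ⥤ D} (h₁ : BoundedLE t t' F 0) (h₂ : BoundedGE t t' F 0) :
    PreservesHeart t t' F := fun X hX =>
  (heart_iff t').2 ⟨h₁ X 0 ((heart_iff t).1 hX).1, h₂ X 0 ((heart_iff t).1 hX).2⟩

/-- Morphisms from `F X` to `Y` are morphisms from `X` to `G Y`, and being bounded above is detected
by orthogonality; hence bounds pass to the adjoint with the sign of `k` reversed. -/
theorem boundedLE_of_adjunction {F : C ⥤ D} {G : D ⥤ C} [F.Additive] (adj : F ⊣ G) {k : ℤ}
    (h : BoundedGE t' t G (-k)) : BoundedLE t t' F k := by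
  intro X n hX
  rw [t'.isLE_iff_orthogonal (n + k) (n + k + 1) rfl]
  intro Y f hY
  have := h Y _ hY
  exact (adj.homAddEquiv X Y).map_eq_zero_iff.1 (t.zero _ n (n + k + 1 + -k))

theorem boundedGE_of_adjunction {F : C ⥤ D} {G : D ⥤ C} [F.Additive] (adj : F ⊣ G) {k : ℤ}
    (h : BoundedLE t t' F (-k)) : BoundedGE t' t G k := by
  intro Y n hY
  rw [t.isGE_iff_orthogonal (n + k - 1) (n + k) (by ring)]
  intro X f hX
  have := h X _ hX
  exact (adj.homAddEquiv X Y).symm.map_eq_zero_iff.1 (t'.zero _ (n + k - 1 + -k) n)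

/-- A heart preserving functor without kernel reflects the heart. -/
theorem heart_of_heart_obj [IsTriangulated C] (hb : t.bounded = ⊤) {F : C ⥤ D} [F.CommShift ℤ]
    [F.IsTriangulated] (h : PreservesHeart t t' F) (h0 : ∀ X, IsZero (F.obj X) → IsZero X) {X : C}
    (hX : t'.heart (F.obj X)) : t.heart X := by
  rw [heart_iff] at hX ⊢
  obtain ⟨hX₁, hX₂⟩ := hX
  constructor
  · rw [t.isLE_iff_isZero_truncGE_obj 0 1 rfl]
    apply h0
    -- The image of the part of `X` in degrees `≥ 1` is both `≥ 1` by exactness and `≤ 0` by the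
    -- triangle.
    have hT := Functor.map_mk_distinguished F (t.triangleLTGE_distinguished 1 X)
    have h1 : t'.IsLE (F.obj ((t.truncLT 1).obj X)) 0 :=
      by simpa using h.boundedLE hb _ 0 (t.isLE_truncLT_obj ..)
    have h2 : t'.IsLE (F.obj ((t.truncGE 1).obj X)) 0 :=
      isLE₃_of_triangle hT 0 (t'.isLE_of_le _ 0 _) hX₁
    have h3 : t'.IsGE (F.obj ((t.truncGE 1).obj X)) 1 :=
      by simpa using h.boundedGE hb _ 1 (t.isGE_truncGE_obj ..)
    exact t'.isZero _ 0 1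
  · rw [t.isGE_iff_isZero_truncLT_obj 0]
    apply h0
    have hT := Functor.map_mk_distinguished F (t.triangleLTGE_distinguished 0 X)
    have h1 : t'.IsGE (F.obj ((t.truncGE 0).obj X)) 0 :=
      by simpa using h.boundedGE hb _ 0 (t.isGE_truncGE_obj ..)
    have h2 : t'.IsGE (F.obj ((t.truncLT 0).obj X)) 0 :=
      isGE₁_of_triangle hT 0 hX₂ (t'.isGE_of_ge _ _ 0)
    have h3 : t'.IsLE (F.obj ((t.truncLT 0).obj X)) (-1) :=
      by simpa using h.boundedLE hb _ (-1) (t.isLE_truncLT_obj ..)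
    exact t'.isZero _ (-1) 0

end Functors

/-! ### Slope comparison by cross products in the half plane. -/

section Cross

/-- The cross product of two vectors of `ℂ = ℝ²`, normalised so that it is positive if the slope of
`z` exceeds the slope of `w`. -/
def cross (z w : ℂ) : ℝ := w.re * z.im - z.re * w.im

theorem cross_add_left (z z' w : ℂ) : cross (z + z') w = cross z w + cross z' w := by
  simp only [cross, Complex.add_re, Complex.add_im]; ring

theorem cross_self (z : ℂ) : cross z z = 0 := by simp only [cross]; ring

theorem cross_zero_left (w : ℂ) : cross 0 w = 0 := by simp [cross]

theorem cross_smul (c d : ℝ) (z w : ℂ) : cross (c * z) (d * w) = c * d * cross z w := by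
  simp only [cross, Complex.mul_re, Complex.mul_im, Complex.ofReal_re, Complex.ofReal_im]; ring

theorem cross_swap (z w : ℂ) : cross w z = - cross z w := by simp only [cross]; ring

/-- The union of the open upper half plane and the negative real axis. -/
def InHalfPlane (z : ℂ) : Prop := 0 < z.im ∨ (z.im = 0 ∧ z.re < 0)

theorem InHalfPlane.ne_zero {z : ℂ} (h : InHalfPlane z) : z ≠ 0 := by
  rintro rfl
  rcases h with h | h <;> simp at h

theorem InHalfPlane.add_ne_zero {z w : ℂ} (hz : InHalfPlane z) (hw : InHalfPlane w) :
    z + w ≠ 0 := by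
  intro h
  have h1 := congrArg Complex.re h
  have h2 := congrArg Complex.im h
  simp only [Complex.add_re, Complex.add_im, Complex.zero_re, Complex.zero_im] at h1 h2
  rcases hz with hz | hz <;> rcases hw with hw | hw <;> linarith

theorem InHalfPlane.smul {z : ℂ} (h : InHalfPlane z) {c : ℝ} (hc : 0 < c) :
    InHalfPlane (c * z) := by
  rcases h with h | h
  · left
    simpa using mul_pos hc h
  · right
    simpa [h.1] using mul_neg_of_pos_of_neg hc h.2

theorem InHalfPlane.exists_smul_eq {z w : ℂ} (hz : InHalfPlane z) (hw : InHalfPlane w)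
    (h : cross z w = 0) : ∃ c : ℝ, 0 < c ∧ z = c * w := by
  simp only [cross] at h
  rcases hw with hw | ⟨hw1, hw2⟩
  · rcases hz with hz | ⟨hz1, hz2⟩
    · refine ⟨z.im / w.im, div_pos hz hw, Complex.ext ?_ ?_⟩
      · simp only [Complex.mul_re, Complex.ofReal_re, Complex.ofReal_im]
        field_simp
        linarith
      · simp only [Complex.mul_im, Complex.ofReal_re, Complex.ofReal_im]
        field_simp
        ring
    · rw [hz1] at h
      nlinarith
  · rcases hz with hz | ⟨hz1, hz2⟩
    · rw [hw1] at h
      nlinarith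
    · refine ⟨z.re / w.re, div_pos_of_neg_of_neg hz2 hw2, Complex.ext ?_ ?_⟩
      · simp [div_mul_cancel₀ _ hw2.ne]
      · simp [hz1, hw1]

end Cross

/-! ### Vanishing of morphisms, Serre duality and finite type. -/

section Homs

variable {C : Type u} [Category.{v} C] [Preadditive C] [Linear ℂ C] [HasShift C ℤ]

theorem chi_nonneg {E F : C} (h : ∀ n : ℤ, Odd n → ∀ f : E ⟶ F⟦n⟧, f = 0) : 0 ≤ chi E F := by
  refine finsum_nonneg fun n => ?_
  rcases Int.even_or_odd n with hn | hn
  · rw [Int.negOnePow_even n hn]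
    simp
  · have : Subsingleton (E ⟶ F⟦n⟧) := ⟨fun f g => by rw [h n hn f, h n hn g]⟩
    rw [Module.finrank_zero_of_subsingleton]
    simp

omit [HasShift C ℤ] in
theorem IsSerreFunctor.hom_eq_zero {S : C ⥤ C} (hS : IsSerreFunctor S) {E F : C}
    (h : ∀ g : F ⟶ S.obj E, g = 0) (f : E ⟶ F) : f = 0 := by
  obtain ⟨-, η, -⟩ := hS
  have : Subsingleton (F ⟶ S.obj E) := ⟨fun a b => by rw [h a, h b]⟩
  exact (η E F).map_eq_zero_iff.1 (Subsingleton.elim _ _)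

/-- An object with `X ≅ X[2]` vanishes in a category of finite type. -/
theorem isZero_of_iso_shift_two [IsFiniteType C] {X : C} (e : X ≅ X⟦(2 : ℤ)⟧) : IsZero X := by
  -- Iterating gives an isomorphism with every even positive shift, so a nonzero `X` would have
  -- nonzero morphisms to infinitely many of its shifts.
  have key : ∀ n : ℕ, Nonempty (X ≅ X⟦(2 * n : ℤ)⟧) := by
    intro n
    induction n with
    | zero => exact ⟨((shiftFunctorZero C ℤ).app X).symm⟩
    | succ n ih =>
      obtain ⟨a⟩ := ih
      exact ⟨e ≪≫ (shiftFunctor C (2 : ℤ)).mapIso a ≪≫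
        ((shiftFunctorAdd' C (2 * n : ℤ) 2 (2 * (n + 1 : ℕ) : ℤ) (by push_cast; ring)).app X).symm⟩
  by_contra hX
  have hinj : Function.Injective fun n : ℕ => (2 * n : ℤ) := fun a b hab => by
    simpa using hab
  refine Set.infinite_range_of_injective hinj ((IsFiniteType.finite_support X X).subset ?_)
  rintro _ ⟨n, rfl⟩
  obtain ⟨a⟩ := key n
  have : Nontrivial (X ⟶ X⟦(2 * n : ℤ)⟧) := by
    refine ⟨a.hom, 0, fun h0 => hX ((IsZero.iff_id_eq_zero X).2 ?_)⟩
    rw [← a.hom_inv_id, h0, zero_comp]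
  exact (Module.finrank_pos (R := ℂ)).ne'

end Homs

/-! ### Numerical classes of objects. -/

section Classes

open ZeroObject

variable {C : Type u} [Category.{v} C] [HasZeroObject C] [HasShift C ℤ] [Preadditive C]
  [∀ n : ℤ, (shiftFunctor C n).Additive] [Pretriangulated C] [Linear ℂ C]
  [∀ n : ℤ, (shiftFunctor C n).Linear ℂ] [IsFiniteType C]

omit [Linear ℂ C] [∀ n : ℤ, (shiftFunctor C n).Linear ℂ] [IsFiniteType C] in
theorem mk_distinguished_of_iso {X Y Z X' Y' Z' : C} {f : X ⟶ Y} {g : Y ⟶ Z} {h : Z ⟶ X⟦(1 : ℤ)⟧}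
    (hT : Triangle.mk f g h ∈ distTriang C) {f' : X' ⟶ Y'} {g' : Y' ⟶ Z'} {h' : Z' ⟶ X'⟦(1 : ℤ)⟧}
    (a : X' ≅ X) (b : Y' ≅ Y) (c : Z' ≅ Z) (h₁ : f' ≫ b.hom = a.hom ≫ f)
    (h₂ : g' ≫ c.hom = b.hom ≫ g) (h₃ : h' ≫ a.hom⟦(1 : ℤ)⟧' = c.hom ≫ h) :
    Triangle.mk f' g' h' ∈ distTriang C :=
  isomorphic_distinguished _ hT _ (Triangle.isoMk _ _ a b c h₁ h₂ h₃)

omit [Linear ℂ C] [∀ n : ℤ, (shiftFunctor C n).Linear ℂ] [IsFiniteType C] in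
theorem triangle_mk_iso {A E E' B : C} {f : A ⟶ E'} {g : E' ⟶ B} {h : B ⟶ A⟦(1 : ℤ)⟧}
    (hT : Triangle.mk f g h ∈ distTriang C) (e : E ≅ E') :
    Triangle.mk (f ≫ e.inv) (e.hom ≫ g) h ∈ distTriang C :=
  mk_distinguished_of_iso hT (Iso.refl _) e (Iso.refl _) (by simp) (by simp) (by simp)

theorem cls_triangle {X Y Z : C} {f : X ⟶ Y} {g : Y ⟶ Z} {h : Z ⟶ X⟦(1 : ℤ)⟧}
    (hT : Triangle.mk f g h ∈ distTriang C) : cls Y = cls X + cls Z := by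
  have h0 : K0.of Y = K0.of X + K0.of Z := by
    rw [← sub_eq_zero]
    exact (QuotientAddGroup.eq_zero_iff _).2 (AddSubgroup.subset_closure ⟨_, hT, rfl⟩)
  exact congrArg (QuotientAddGroup.mk' (eulerKer C)) h0

theorem cls_eq_zero {X : C} (hX : IsZero X) : cls X = 0 := by
  have h2 : cls (0 : C) = 0 := by
    have := cls_triangle (contractible_distinguished (0 : C))
    simpa using this
  have h3 : Triangle.mk (𝟙 X) (𝟙 X) (0 : X ⟶ X⟦(1 : ℤ)⟧) ∈ distTriang C :=
    mk_distinguished_of_iso (contractible_distinguished X) (Iso.refl _) (Iso.refl _) hX.isoZero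
      (by simp) (hX.eq_of_src _ _) (hX.eq_of_src _ _)
  simpa using cls_triangle h3

theorem cls_iso {X Y : C} (e : X ≅ Y) : cls X = cls Y := by
  have h3 : Triangle.mk e.hom (0 : Y ⟶ 0) (0 : (0 : C) ⟶ X⟦(1 : ℤ)⟧) ∈ distTriang C :=
    mk_distinguished_of_iso (contractible_distinguished X) (Iso.refl _) e.symm (Iso.refl _)
      (by simp) ((isZero_zero C).eq_of_tgt _ _) ((isZero_zero C).eq_of_src _ _)
  rw [cls_triangle h3, cls_eq_zero (isZero_zero C), add_zero]

theorem cls_shift_one (X : C) : cls (X⟦(1 : ℤ)⟧) = - cls X := by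
  have h := cls_triangle (contractible_distinguished₂ X)
  rw [cls_eq_zero (isZero_zero C)] at h
  exact (neg_eq_of_add_eq_zero_right h.symm).symm

end Classes

/-! ### Semistable and stable objects of a heart. -/

namespace HeartWithStabilityFunction

variable {C : Type u} [Category.{v} C] [HasZeroObject C] [HasShift C ℤ] [Preadditive C]
  [∀ n : ℤ, (shiftFunctor C n).Additive] [Pretriangulated C] [Linear ℂ C]
  [∀ n : ℤ, (shiftFunctor C n).Linear ℂ] [IsFiniteType C]
  (σ : HeartWithStabilityFunction C)

/-- The central charge of an object. -/
noncomputable def charge (E : C) : ℂ := σ.Z (cls E)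

variable {σ}

theorem charge_triangle {X Y Z : C} {f : X ⟶ Y} {g : Y ⟶ Z} {h : Z ⟶ X⟦(1 : ℤ)⟧}
    (hT : Triangle.mk f g h ∈ distTriang C) : σ.charge Y = σ.charge X + σ.charge Z := by
  rw [charge, cls_triangle hT, map_add]; rfl

theorem charge_iso {X Y : C} (e : X ≅ Y) : σ.charge X = σ.charge Y := by
  rw [charge, cls_iso e]; rfl

theorem charge_eq_zero {X : C} (hX : IsZero X) : σ.charge X = 0 := by
  rw [charge, cls_eq_zero hX, map_zero]

theorem charge_shift_one (X : C) : σ.charge (X⟦(1 : ℤ)⟧) = - σ.charge X := by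
  rw [charge, cls_shift_one, map_neg]; rfl

theorem charge_shift_neg_one (X : C) : σ.charge (X⟦(-1 : ℤ)⟧) = - σ.charge X := by
  have e : (X⟦(-1 : ℤ)⟧)⟦(1 : ℤ)⟧ ≅ X := (shiftEquiv C (1 : ℤ)).counitIso.app X
  rw [← charge_iso e, charge_shift_one, neg_neg]

theorem inHalfPlane {E : C} (hE : σ.t.heart E) (h0 : ¬ IsZero E) : InHalfPlane (σ.charge E) :=
  σ.upper_half_plane E hE h0

theorem isZero_of_charge {E : C} (hE : σ.t.heart E) (h : σ.charge E = 0) : IsZero E := by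
  by_contra h0
  exact (inHalfPlane hE h0).ne_zero h

theorem isZero_of_charge_add {E F : C} (hE : σ.t.heart E) (hF : σ.t.heart F)
    (h : σ.charge E + σ.charge F = 0) : IsZero E ∧ IsZero F := by
  by_cases hE0 : IsZero E
  · rw [charge_eq_zero hE0, zero_add] at h
    exact ⟨hE0, isZero_of_charge hF h⟩
  · by_cases hF0 : IsZero F
    · rw [charge_eq_zero hF0, add_zero] at h
      exact ⟨isZero_of_charge hE h, hF0⟩
    · exact absurd h ((inHalfPlane hE hE0).add_ne_zero (inHalfPlane hF hF0))

/-- The slope `⊤` needs no exception: on the negative real axis the cross product has the sign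
dictated by infinite slope. -/
theorem slope_le_slope_iff {A E : C} (hA : σ.t.heart A) (hA0 : ¬ IsZero A) (hE : σ.t.heart E)
    (hE0 : ¬ IsZero E) : σ.slope A ≤ σ.slope E ↔ cross (σ.charge A) (σ.charge E) ≤ 0 := by
  have h1 := inHalfPlane hA hA0
  have h2 := inHalfPlane hE hE0
  simp only [slope, ← charge.eq_1 σ, cross]
  generalize σ.charge A = z at *
  generalize σ.charge E = w at *
  rcases h2 with h2 | ⟨h2, h2'⟩
  · rcases h1 with h1 | ⟨h1, h1'⟩
    · rw [if_pos h1, if_pos h2, EReal.coe_le_coe_iff, div_le_div_iff₀ h1 h2]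
      constructor <;> intro h <;> linarith
    · rw [if_neg (by rw [h1]; exact lt_irrefl _), if_pos h2, h1]
      simp only [top_le_iff, EReal.coe_ne_top, false_iff, not_le]
      nlinarith
  · rw [if_neg (show ¬ 0 < w.im by rw [h2]; exact lt_irrefl _), h2]
    simp only [le_top, true_iff]
    rcases h1 with h1 | ⟨h1, h1'⟩
    · nlinarith
    · rw [h1]; simp

theorem slope_lt_slope_iff {A E : C} (hA : σ.t.heart A) (hA0 : ¬ IsZero A) (hE : σ.t.heart E)
    (hE0 : ¬ IsZero E) : σ.slope A < σ.slope E ↔ cross (σ.charge A) (σ.charge E) < 0 := by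
  rw [← not_le, slope_le_slope_iff hE hE0 hA hA0, cross_swap, not_le, neg_pos]

/-- The conditions that sub and quotient be nonzero disappear, since in both degenerate cases the
cross product is zero. The strict inequality of stability has to keep them. -/
theorem heartSemistable_iff {E : C} : σ.HeartSemistable E ↔ σ.t.heart E ∧ ¬ IsZero E ∧
    ∀ ⦃A B : C⦄ (f : A ⟶ E) (g : E ⟶ B) (h : B ⟶ A⟦(1 : ℤ)⟧), Triangle.mk f g h ∈ distTriang C →
      σ.t.heart A → σ.t.heart B → cross (σ.charge A) (σ.charge E) ≤ 0 := by
  constructor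
  · rintro ⟨hE, hE0, H⟩
    refine ⟨hE, hE0, fun A B f g h hT hA hB => ?_⟩
    by_cases hA0 : IsZero A
    · rw [charge_eq_zero hA0, cross_zero_left]
    by_cases hB0 : IsZero B
    · rw [charge_triangle hT, charge_eq_zero hB0, add_zero, cross_self]
    exact (slope_le_slope_iff hA hA0 hE hE0).1 (H _ hT rfl hA hB hA0 hB0)
  · rintro ⟨hE, hE0, H⟩
    refine ⟨hE, hE0, ?_⟩
    rintro ⟨A, _, B, f, g, h⟩ hT rfl hA hB hA0 hB0
    exact (slope_le_slope_iff hA hA0 hE hE0).2 (H f g h hT hA hB)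

theorem heartStable_iff {E : C} : σ.HeartStable E ↔ σ.t.heart E ∧ ¬ IsZero E ∧
    ∀ ⦃A B : C⦄ (f : A ⟶ E) (g : E ⟶ B) (h : B ⟶ A⟦(1 : ℤ)⟧), Triangle.mk f g h ∈ distTriang C →
      σ.t.heart A → σ.t.heart B → ¬ IsZero A → ¬ IsZero B →
        cross (σ.charge A) (σ.charge E) < 0 := by
  constructor
  · rintro ⟨hE, hE0, H⟩
    refine ⟨hE, hE0, fun A B f g h hT hA hB hA0 hB0 => ?_⟩
    exact (slope_lt_slope_iff hA hA0 hE hE0).1 (H _ hT rfl hA hB hA0 hB0)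
  · rintro ⟨hE, hE0, H⟩
    refine ⟨hE, hE0, ?_⟩
    rintro ⟨A, _, B, f, g, h⟩ hT rfl hA hB hA0 hB0
    exact (slope_lt_slope_iff hA hA0 hE hE0).2 (H f g h hT hA hB hA0 hB0)

theorem HeartStable.heartSemistable {E : C} (h : σ.HeartStable E) : σ.HeartSemistable E :=
  ⟨h.1, h.2.1, fun T hT h2 h1 h3 h10 h30 => (h.2.2 T hT h2 h1 h3 h10 h30).le⟩

theorem HeartSemistable.of_iso {E E' : C} (e : E ≅ E') (h : σ.HeartSemistable E) :
    σ.HeartSemistable E' := by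
  rw [heartSemistable_iff] at h ⊢
  refine ⟨heart_of_iso e h.1, fun h0 => h.2.1 (h0.of_iso e), fun A B f g k hT hA hB => ?_⟩
  rw [← charge_iso e]
  exact h.2.2 _ _ _ (triangle_mk_iso hT e) hA hB

theorem HeartStable.of_iso {E E' : C} (e : E ≅ E') (h : σ.HeartStable E) :
    σ.HeartStable E' := by
  rw [heartStable_iff] at h ⊢
  refine ⟨heart_of_iso e h.1, fun h0 => h.2.1 (h0.of_iso e),
    fun A B f g k hT hA hB hA0 hB0 => ?_⟩
  rw [← charge_iso e]
  exact h.2.2 _ _ _ (triangle_mk_iso hT e) hA hB hA0 hB0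

section Triangulated

variable [IsTriangulated C]

/-- The kernel in the heart vanishes, so `A` has the charge of its image, which is an honest
subobject. -/
theorem HeartSemistable.cross_le {E A : C} (hE : σ.HeartSemistable E) (hA : σ.t.heart A)
    {f : A ⟶ E} (hf : HeartMono σ.t f) : cross (σ.charge A) (σ.charge E) ≤ 0 := by
  rw [heartSemistable_iff] at hE
  obtain ⟨K, I, Q, k, p, d, i, q, e, hK, hI, hQ, hT₁, hT₂, hpi⟩ := exists_heart_image f hA hE.1
  have hk : k = 0 := hf k hK (by
    have h0 : k ≫ p = 0 := comp_distTriang_mor_zero₁₂ _ hT₁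
    rw [← hpi, ← Category.assoc, h0, zero_comp])
  have hK0 : IsZero K := by
    by_contra h
    exact (heartMono_of_triangle hT₁ hI).ne_zero hK h hk
  rw [charge_triangle hT₁, charge_eq_zero hK0, zero_add]
  exact hE.2.2 _ _ _ hT₂ hI hQ

theorem HeartSemistable.le_cross {E B : C} (hE : σ.HeartSemistable E) (hB : σ.t.heart B)
    {f : E ⟶ B} (hf : HeartEpi σ.t f) : 0 ≤ cross (σ.charge B) (σ.charge E) := by
  rw [heartSemistable_iff] at hE
  obtain ⟨K, I, Q, k, p, d, i, q, e, hK, hI, hQ, hT₁, hT₂, hpi⟩ := exists_heart_image f hE.1 hB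
  have hq : q = 0 := hf q hQ (by
    have h0 : i ≫ q = 0 := comp_distTriang_mor_zero₁₂ _ hT₂
    rw [← hpi, Category.assoc, h0, comp_zero])
  have hQ0 : IsZero Q := by
    by_contra h
    exact (heartEpi_of_triangle hT₂ hI).ne_zero hQ h hq
  rw [charge_triangle hT₂, charge_eq_zero hQ0, add_zero]
  have h1 := hE.2.2 _ _ _ hT₁ hK hI
  have h2 := cross_self (σ.charge E)
  nth_rewrite 1 [charge_triangle hT₁] at h2
  rw [cross_add_left] at h2
  linarith

/-- An extension of semistable objects with the same central charge is semistable. -/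
theorem HeartSemistable.of_extension {X Y Z : C} {f : X ⟶ Y} {g : Y ⟶ Z} {h : Z ⟶ X⟦(1 : ℤ)⟧}
    (hT : Triangle.mk f g h ∈ distTriang C) (hX : σ.HeartSemistable X) (hZ : σ.HeartSemistable Z)
    (hXZ : σ.charge X = σ.charge Z) : σ.HeartSemistable Y := by
  have hY : σ.t.heart Y := heart_of_triangle hT hX.1 hZ.1
  have hc : σ.charge Y = (2 : ℝ) * σ.charge Z := by
    rw [charge_triangle hT, hXZ]; push_cast; ring
  have hc2 : ∀ z : ℂ, cross z (σ.charge Y) = 2 * cross z (σ.charge Z) := fun z => by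
    rw [hc]
    simpa using cross_smul 1 2 z (σ.charge Z)
  rw [heartSemistable_iff]
  refine ⟨hY, fun h0 => ?_, fun A B a b c hT' hA hB => ?_⟩
  · have := (inHalfPlane hZ.1 hZ.2.1).smul (c := 2) (by norm_num)
    rw [← hc, charge_eq_zero h0] at this
    exact this.ne_zero rfl
  -- A subobject `A` of `Y` is cut into its image `I` in `Z` and the kernel `K`, which is a
  -- subobject of `X`; both are bounded by the common slope.
  · obtain ⟨K, I, Q, k, p, d, i, q, e, hK, hI, hQ, hT₁, hT₂, hpi⟩ :=
      exists_heart_image (a ≫ g) hA hZ.1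
    have hI' := (heartSemistable_iff.1 hZ).2.2 _ _ _ hT₂ hI hQ
    have h0 : k ≫ p = 0 := comp_distTriang_mor_zero₁₂ _ hT₁
    obtain ⟨l, hl⟩ : ∃ l : K ⟶ X, k ≫ a = l ≫ f :=
      (Triangle.mk f g h).coyoneda_exact₂ hT (k ≫ a) (by
        change (k ≫ a) ≫ g = 0
        rw [Category.assoc, ← hpi, ← Category.assoc, h0, zero_comp])
    have hlm : HeartMono σ.t l := fun M m hM hm =>
      (heartMono_of_triangle hT₁ hI).comp (heartMono_of_triangle hT' hB) m hM (by
        rw [hl, ← Category.assoc, hm, zero_comp])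
    have hK' := hX.cross_le hK hlm
    rw [hXZ] at hK'
    rw [hc2, charge_triangle hT₁, cross_add_left]
    linarith

/-- A nonzero morphism from a semistable object to a stable object of the same slope is
surjective in the heart. -/
theorem exists_kernel_of_ne_zero {X E : C} (hX : σ.HeartSemistable X) (hE : σ.HeartStable E)
    (hc : cross (σ.charge X) (σ.charge E) = 0) {f : X ⟶ E} (hf : f ≠ 0) :
    ∃ K : C, σ.t.heart K ∧ σ.charge X = σ.charge E + σ.charge K ∧ (IsZero K → IsIso f) := by
  obtain ⟨K, I, Q, k, p, d, i, q, e, hK, hI, hQ, hT₁, hT₂, hpi⟩ := exists_heart_image f hX.1 hE.1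
  have hI0 : ¬ IsZero I := fun h => hf (by rw [← hpi, h.eq_of_src i 0, comp_zero])
  have hQ0 : IsZero Q := by
    -- Otherwise the image is a proper subobject of the stable `E`, of strictly smaller slope,
    -- although as a quotient of the semistable `X` its slope is at least the same common value.
    by_contra hQ0
    have h1 := (heartStable_iff.1 hE).2.2 _ _ _ hT₂ hI hQ hI0 hQ0
    have h2 := (heartSemistable_iff.1 hX).2.2 _ _ _ hT₁ hK hI
    have h3 := cross_self (σ.charge X)
    nth_rewrite 1 [charge_triangle hT₁] at h3
    rw [cross_add_left] at h3
    obtain ⟨c, hc0, hc⟩ := (inHalfPlane hX.1 hX.2.1).exists_smul_eq (inHalfPlane hE.1 hE.2.1) hc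
    have h4 : cross (σ.charge I) (σ.charge X) = c * cross (σ.charge I) (σ.charge E) := by
      rw [hc]
      simpa using cross_smul 1 c (σ.charge I) (σ.charge E)
    nlinarith
  refine ⟨K, hK, ?_, fun hK0 => ?_⟩
  · rw [charge_triangle hT₁, charge_triangle hT₂, charge_eq_zero hQ0, add_zero, add_comm]
  · have h1 : IsIso p := (Triangle.isZero₁_iff_isIso₂ _ hT₁).1 hK0
    have h2 : IsIso i := (Triangle.isZero₃_iff_isIso₁ _ hT₂).1 hQ0
    rw [← hpi]
    infer_instance

/-- A nonzero morphism from a stable object to a semistable object of the same slope is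
injective in the heart. -/
theorem exists_cokernel_of_ne_zero {E X : C} (hE : σ.HeartStable E) (hX : σ.HeartSemistable X)
    (hc : cross (σ.charge X) (σ.charge E) = 0) {f : E ⟶ X} (hf : f ≠ 0) :
    ∃ K : C, σ.t.heart K ∧ σ.charge X = σ.charge E + σ.charge K := by
  obtain ⟨K, I, Q, k, p, d, i, q, e, hK, hI, hQ, hT₁, hT₂, hpi⟩ := exists_heart_image f hE.1 hX.1
  have hI0 : ¬ IsZero I := fun h => hf (by rw [← hpi, h.eq_of_src i 0, comp_zero])
  have hK0 : IsZero K := by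
    by_contra hK0
    have h1 := (heartStable_iff.1 hE).2.2 _ _ _ hT₁ hK hI hK0 hI0
    have h2 := (heartSemistable_iff.1 hX).2.2 _ _ _ hT₂ hI hQ
    have h3 := cross_self (σ.charge E)
    nth_rewrite 1 [charge_triangle hT₁] at h3
    rw [cross_add_left] at h3
    obtain ⟨c, hc0, hc⟩ := (inHalfPlane hX.1 hX.2.1).exists_smul_eq (inHalfPlane hE.1 hE.2.1) hc
    have h4 : cross (σ.charge I) (σ.charge X) = c * cross (σ.charge I) (σ.charge E) := by
      rw [hc]
      simpa using cross_smul 1 c (σ.charge I) (σ.charge E)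
    nlinarith
  refine ⟨Q, hQ, ?_⟩
  rw [charge_triangle hT₁, charge_triangle hT₂, charge_eq_zero hK0, zero_add]

end Triangulated

/-- A self-extension in the heart, up to the central charge, is not stable. -/
theorem not_heartStable_of_extension {X Y Z : C} {f : X ⟶ Y} {g : Y ⟶ Z} {h : Z ⟶ X⟦(1 : ℤ)⟧}
    (hT : Triangle.mk f g h ∈ distTriang C) (hX : σ.t.heart X) (hZ : σ.t.heart Z)
    (hXZ : σ.charge X = σ.charge Z) (hZ0 : ¬ IsZero Z) : ¬ σ.HeartStable Y := by
  intro hY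
  have hX0 : ¬ IsZero X := fun h0 =>
    hZ0 (isZero_of_charge hZ (by rw [← hXZ, charge_eq_zero h0]))
  have h1 := (heartStable_iff.1 hY).2.2 _ _ _ hT hX hZ hX0 hZ0
  have hc : σ.charge Y = (2 : ℝ) * σ.charge X := by
    rw [charge_triangle hT, ← hXZ]; push_cast; ring
  have h2 := cross_smul 1 2 (σ.charge X) (σ.charge X)
  rw [cross_self, ← hc] at h2
  simp only [Complex.ofReal_one, one_mul, mul_zero] at h2
  linarith

end HeartWithStabilityFunction

/-! ### Transfer of stability along t-exact functors and adjunctions. -/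

section Transfer

variable {C : Type u} [Category.{v} C] [HasZeroObject C] [HasShift C ℤ] [Preadditive C]
  [∀ n : ℤ, (shiftFunctor C n).Additive] [Pretriangulated C] [Linear ℂ C]
  [∀ n : ℤ, (shiftFunctor C n).Linear ℂ] [IsFiniteType C]
  {D : Type u'} [Category.{v'} D] [HasZeroObject D] [HasShift D ℤ] [Preadditive D]
  [∀ n : ℤ, (shiftFunctor D n).Additive] [Pretriangulated D] [Linear ℂ D]
  [∀ n : ℤ, (shiftFunctor D n).Linear ℂ] [IsFiniteType D]
  {σ : HeartWithStabilityFunction C} {τ : HeartWithStabilityFunction D}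

open HeartWithStabilityFunction

variable (σ τ) in
/-- The functor multiplies central charges by the real number `c`. -/
def ScalesCharge (F : C ⥤ D) (c : ℝ) : Prop := ∀ E : C, τ.charge (F.obj E) = c * σ.charge E

theorem not_isZero_obj {F : C ⥤ D} {c : ℝ} (hc : 0 < c) (hZ : ScalesCharge σ τ F c) {E : C}
    (hE : σ.t.heart E) (hE0 : ¬ IsZero E) : ¬ IsZero (F.obj E) := fun h0 => by
  have h1 := ((inHalfPlane hE hE0).smul hc).ne_zero
  rw [← hZ, charge_eq_zero h0] at h1
  exact h1 rfl

/-- A destabilising subobject of `E` maps to a subobject of `F E`, and multiplying charges by `c`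
multiplies the cross product by `c * c > 0`, so it would still destabilise. -/
theorem heartSemistable_of_obj {F : C ⥤ D} [F.CommShift ℤ] [F.IsTriangulated] {c : ℝ} (hc : 0 < c)
    (hF : PreservesHeart σ.t τ.t F) (hZ : ScalesCharge σ τ F c) {E : C} (hE : σ.t.heart E)
    (h : τ.HeartSemistable (F.obj E)) : σ.HeartSemistable E := by
  rw [heartSemistable_iff] at h ⊢
  refine ⟨hE, fun h0 => h.2.1 (F.map_isZero h0), fun A B f g k hT hA hB => ?_⟩
  have h1 := h.2.2 _ _ _ (Functor.map_mk_distinguished F hT) (hF A hA) (hF B hB)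
  rw [hZ, hZ, cross_smul] at h1
  exact nonpos_of_mul_nonpos_right h1 (mul_pos hc hc)

theorem heartStable_of_obj {F : C ⥤ D} [F.CommShift ℤ] [F.IsTriangulated] {c : ℝ} (hc : 0 < c)
    (hF : PreservesHeart σ.t τ.t F) (hZ : ScalesCharge σ τ F c) {E : C} (hE : σ.t.heart E)
    (h : τ.HeartStable (F.obj E)) : σ.HeartStable E := by
  rw [heartStable_iff] at h ⊢
  refine ⟨hE, fun h0 => h.2.1 (F.map_isZero h0), fun A B f g k hT hA hB hA0 hB0 => ?_⟩
  have h1 := h.2.2 _ _ _ (Functor.map_mk_distinguished F hT) (hF A hA) (hF B hB)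
    (not_isZero_obj hc hZ hA hA0) (not_isZero_obj hc hZ hB hB0)
  rw [hZ, hZ, cross_smul] at h1
  exact neg_of_mul_neg_right h1 (mul_pos hc hc).le

theorem heartPhase_obj {F : C ⥤ D} {c : ℝ} (hc : 0 < c) (hZ : ScalesCharge σ τ F c) (E : C) :
    τ.heartPhase (F.obj E) = σ.heartPhase E := by
  have h := hZ E
  unfold charge at h
  rw [heartPhase, h, Complex.arg_real_mul _ hc, heartPhase]

theorem heartPhase_iso {E E' : C} (e : E ≅ E') : σ.heartPhase E = σ.heartPhase E' := by
  rw [heartPhase, cls_iso e, heartPhase]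

/-- If `E` is stable and `F E` is semistable but not stable, then `E` is the image of a stable
object under the left adjoint of `F`. -/
theorem exists_heartStable_of_not_heartStable [IsTriangulated C] [IsTriangulated D]
    {F : C ⥤ D} [F.CommShift ℤ] [F.IsTriangulated]
    {L R : D ⥤ C} [L.CommShift ℤ] [L.IsTriangulated] (adjL : L ⊣ F) (adjR : F ⊣ R)
    {c d : ℝ} (hd : 0 < d) (hcd : c * d = 2) (hF : ScalesCharge σ τ F c)
    (hL : ScalesCharge τ σ L d) (hR : ScalesCharge τ σ R d)
    (hLs : ∀ Y, τ.HeartSemistable Y → σ.HeartSemistable (L.obj Y))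
    (hRs : ∀ Y, τ.HeartSemistable Y → σ.HeartSemistable (R.obj Y))
    {E : C} (hE : σ.HeartStable E) (hFE : τ.HeartSemistable (F.obj E))
    (hFE' : ¬ τ.HeartStable (F.obj E)) :
    ∃ Y : D, τ.HeartStable Y ∧ Nonempty (L.obj Y ≅ E) := by
  have hc : 0 < c := by
    by_contra h
    nlinarith
  have hss := heartSemistable_iff.1 hFE
  rw [heartStable_iff] at hFE'
  push Not at hFE'
  obtain ⟨A, B, f, g, h, hT, hA, hB, hA0, hB0, hAB⟩ := hFE' hss.1 hss.2.1
  have hAE : cross (τ.charge A) (τ.charge (F.obj E)) = 0 :=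
    le_antisymm (hss.2.2 _ _ _ hT hA hB) hAB
  have hBE : cross (τ.charge B) (τ.charge (F.obj E)) = 0 := by
    have h1 := cross_self (τ.charge (F.obj E))
    nth_rewrite 1 [charge_triangle hT] at h1
    rw [cross_add_left] at h1
    linarith
  have scale : ∀ z : ℂ, cross z (τ.charge (F.obj E)) = c * cross z (σ.charge E) := fun z => by
    rw [hF]
    simpa using cross_smul 1 c z (σ.charge E)
  have scaleL : ∀ z : ℂ, cross z (τ.charge (F.obj E)) = 0 → cross (d * z) (σ.charge E) = 0 :=
    fun z hz => by
      rw [scale] at hz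
      have h1 := cross_smul d 1 z (σ.charge E)
      simp only [Complex.ofReal_one, one_mul, mul_one] at h1
      rw [h1, (mul_eq_zero.1 hz).resolve_left hc.ne', mul_zero]
  -- the subobjects and quotients of `F E` of the same slope are semistable
  have hsub : ∀ (A' : D) (a : A' ⟶ F.obj E), τ.t.heart A' → ¬ IsZero A' →
      HeartMono τ.t a → cross (τ.charge A') (τ.charge (F.obj E)) = 0 → τ.HeartSemistable A' := by
    intro A' a hA' hA'0 ha hc'
    refine heartSemistable_iff.2 ⟨hA', hA'0, fun M N m n k hT' hM hN => ?_⟩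
    obtain ⟨r, hr, hr'⟩ := (inHalfPlane hA' hA'0).exists_smul_eq (inHalfPlane hss.1 hss.2.1) hc'
    have h1 := cross_smul 1 r (τ.charge M) (τ.charge (F.obj E))
    simp only [Complex.ofReal_one, one_mul] at h1
    rw [hr', h1]
    exact mul_nonpos_of_nonneg_of_nonpos hr.le
      (hFE.cross_le hM ((heartMono_of_triangle hT' hN).comp ha))
  have hAs : τ.HeartSemistable A := hsub A f hA hA0 (heartMono_of_triangle hT hB) hAE
  have hBs : τ.HeartSemistable B := by
    refine heartSemistable_iff.2 ⟨hB, hB0, fun M N m n k hT' hM hN => ?_⟩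
    obtain ⟨r, hr, hr'⟩ := (inHalfPlane hB hB0).exists_smul_eq (inHalfPlane hss.1 hss.2.1) hBE
    have h1 := cross_smul 1 r (τ.charge N) (τ.charge (F.obj E))
    simp only [Complex.ofReal_one, one_mul] at h1
    have h2 := hFE.le_cross hN ((heartEpi_of_triangle hT hA).comp (heartEpi_of_triangle hT' hM))
    have h3 := cross_self (τ.charge B)
    nth_rewrite 1 [charge_triangle hT'] at h3
    rw [cross_add_left] at h3
    rw [← hr'] at h1
    nlinarith
  -- nonzero subobjects of `F E` of the same slope map onto `E`
  have hquot : ∀ (A' : D) (a : A' ⟶ F.obj E), τ.t.heart A' → ¬ IsZero A' → HeartMono τ.t a →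
      cross (τ.charge A') (τ.charge (F.obj E)) = 0 → ∃ K : C, σ.t.heart K ∧
        d * τ.charge A' = σ.charge E + σ.charge K ∧ (IsZero K → Nonempty (L.obj A' ≅ E)) := by
    intro A' a hA' hA'0 ha hc'
    have hs := hsub A' a hA' hA'0 ha hc'
    -- The adjoint morphism `L A' → E` is nonzero between objects of equal slope, hence surjective
    -- onto the stable `E`.
    obtain ⟨K, hK, hK1, hK2⟩ := exists_kernel_of_ne_zero (hLs _ hs) hE
      (by rw [hL]; exact scaleL _ hc') (f := (adjL.homEquiv A' E).symm a) (fun h0 =>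
        ha.ne_zero hA' hA'0 ((adjL.homAddEquiv A' E).symm.map_eq_zero_iff.1 h0))
    refine ⟨K, hK, by rw [← hL, hK1], fun hK0 => ?_⟩
    exact ⟨@asIso _ _ _ _ _ (hK2 hK0)⟩
  obtain ⟨K₁, hK₁, hKA, hKiso⟩ := hquot A f hA hA0 (heartMono_of_triangle hT hB) hAE
  obtain ⟨K₂, hK₂, hKB⟩ := exists_cokernel_of_ne_zero hE (hRs _ hBs)
    (by rw [hR]; exact scaleL _ hBE) (f := adjR.homEquiv E B g) (fun h0 =>
      (heartEpi_of_triangle hT hA).ne_zero hB hB0 ((adjR.homAddEquiv E B).map_eq_zero_iff.1 h0))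
  rw [hR] at hKB
  -- Adding the two charge relations gives `d Z(F E) = 2 Z(E) + Z(K₁) + Z(K₂)`, while `d Z(F E) = c
  -- d Z(E) = 2 Z(E)`.
  have hsum : σ.charge K₁ + σ.charge K₂ = 0 := by
    have h1 := charge_triangle (σ := τ) hT
    rw [hF] at h1
    have h2 : (c * d : ℂ) = 2 := by exact_mod_cast hcd
    linear_combination (-1 : ℂ) * hKA - hKB - d * h1 + σ.charge E * h2
  have hK₁0 := (isZero_of_charge_add hK₁ hK₂ hsum).1
  refine ⟨A, heartStable_iff.2 ⟨hA, hA0, fun M N m n k hT' hM hN hM0 hN0 => ?_⟩, hKiso hK₁0⟩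
  -- A subobject `M` of `A` of equal slope also satisfies `d Z(M) = Z(E) + Z(K)`. Since `d Z(A) =
  -- Z(E)`, this leaves `d Z(N) + Z(K) = 0`, impossible in the half plane.
  refine lt_of_le_of_ne ((heartSemistable_iff.1 hAs).2.2 _ _ _ hT' hM hN) fun h0 => ?_
  obtain ⟨r, hr, hr'⟩ := (inHalfPlane hA hA0).exists_smul_eq (inHalfPlane hss.1 hss.2.1) hAE
  have h1 := cross_smul 1 r (τ.charge M) (τ.charge (F.obj E))
  simp only [Complex.ofReal_one, one_mul] at h1
  rw [← hr', h0] at h1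
  obtain ⟨K, hK, hKM, -⟩ := hquot M (m ≫ f) hM hM0
    ((heartMono_of_triangle hT' hN).comp (heartMono_of_triangle hT hB))
    ((mul_eq_zero.1 h1.symm).resolve_left hr.ne')
  have h2 := charge_triangle (σ := τ) hT'
  rw [charge_eq_zero hK₁0, add_zero] at hKA
  have h3 : (d * τ.charge N : ℂ) + σ.charge K = 0 := by
    linear_combination (-1 : ℂ) * hKM + hKA - d * h2
  by_cases hK0 : IsZero K
  · rw [charge_eq_zero hK0, add_zero] at h3
    exact ((inHalfPlane hN hN0).smul hd).ne_zero h3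
  · exact ((inHalfPlane hN hN0).smul hd).add_ne_zero (inHalfPlane hK hK0) h3

end Transfer

/-! ### Phases, and invariance of the heart under an involution. -/

section Phases

variable {C : Type u} [Category.{v} C] [HasZeroObject C] [HasShift C ℤ] [Preadditive C]
  [∀ n : ℤ, (shiftFunctor C n).Additive] [Pretriangulated C] [Linear ℂ C]
  [∀ n : ℤ, (shiftFunctor C n).Linear ℂ] [IsFiniteType C]

open HeartWithStabilityFunction

theorem heartPhase_mem (σ : HeartWithStabilityFunction C) {E : C} (hE : σ.t.heart E)
    (hE0 : ¬ IsZero E) : σ.heartPhase E ∈ Set.Ioc (0 : ℝ) 1 := by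
  have h := σ.upper_half_plane E hE hE0
  unfold heartPhase
  generalize σ.Z (cls E) = z at h
  refine ⟨div_pos ?_ Real.pi_pos, div_le_one_of_le₀ (Complex.arg_le_pi z) Real.pi_pos.le⟩
  rcases h with h | ⟨h1, h2⟩
  · refine lt_of_le_of_ne (Complex.arg_nonneg_iff.2 h.le) fun h0 => ?_
    exact h.ne' (Complex.arg_eq_zero_iff.1 h0.symm).2
  · rw [Complex.arg_eq_pi_iff.2 ⟨h2, h1⟩]
    exact Real.pi_pos

theorem int_eq_zero_of_phases {a b : ℝ} (ha : a ∈ Set.Ioc (0 : ℝ) 1) (hb : b ∈ Set.Ioc (0 : ℝ) 1)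
    {n : ℤ} (h : a = b + n) : n = 0 := by
  obtain ⟨ha0, ha1⟩ := ha
  obtain ⟨hb0, hb1⟩ := hb
  have h1 : (n : ℝ) < 1 := by linarith
  have h2 : (-1 : ℝ) < n := by linarith
  have h1' : n < 1 := by exact_mod_cast h1
  have h2' : -1 < n := by exact_mod_cast h2
  lia

variable (σ : StabilityCondition C)

theorem heart_of_isSemistableOfPhase {E : C} {x : ℝ} (hx : x ∈ Set.Ioc (0 : ℝ) 1)
    (h : σ.IsSemistableOfPhase E x) : σ.HeartSemistable E := by
  obtain ⟨A, n, hA, ⟨e⟩, hn⟩ := h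
  obtain rfl := int_eq_zero_of_phases hx (heartPhase_mem _ hA.1 hA.2.1) hn
  exact hA.of_iso ((shiftFunctorZero C ℤ).app A).symm |>.of_iso e.symm

theorem heartStable_of_isStableOfPhase {E : C} {x : ℝ} (hx : x ∈ Set.Ioc (0 : ℝ) 1)
    (h : σ.IsStableOfPhase E x) : σ.HeartStable E := by
  obtain ⟨A, n, hA, ⟨e⟩, hn⟩ := h
  obtain rfl := int_eq_zero_of_phases hx (heartPhase_mem _ hA.1 hA.2.1) hn
  exact hA.of_iso ((shiftFunctorZero C ℤ).app A).symm |>.of_iso e.symm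

theorem isSemistableOfPhase_heartPhase {E : C} (h : σ.HeartSemistable E) :
    σ.IsSemistableOfPhase E (σ.heartPhase E) :=
  ⟨E, 0, h, ⟨((shiftFunctorZero C ℤ).app E).symm⟩, by simp⟩

theorem isStableOfPhase_heartPhase {E : C} (h : σ.HeartStable E) :
    σ.IsStableOfPhase E (σ.heartPhase E) :=
  ⟨E, 0, h, ⟨((shiftFunctorZero C ℤ).app E).symm⟩, by simp⟩

theorem isSemistableOfPhase_unique {E E' : C} (e : E ≅ E') {x y : ℝ}
    (hx : σ.IsSemistableOfPhase E x) (hy : σ.IsSemistableOfPhase E' y) : x = y := by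
  obtain ⟨A, n, hA, ⟨a⟩, rfl⟩ := hx
  obtain ⟨B, m, hB, ⟨b⟩, rfl⟩ := hy
  have i := a.symm ≪≫ e ≪≫ b
  obtain rfl := shift_eq_of_heart hA.1 hB.1 hA.2.1 i
  obtain ⟨j⟩ := nonempty_iso_of_shift_iso i
  rw [heartPhase_iso j]

theorem heart_induction_of_HNFiltration (σ : HeartWithStabilityFunction C) (P : C → Prop)
    (h0 : ∀ E, IsZero E → P E) (hs : ∀ E, σ.HeartSemistable E → P E)
    (hext : ∀ ⦃X Y Z : C⦄ (f : X ⟶ Y) (g : Y ⟶ Z) (h : Z ⟶ X⟦(1 : ℤ)⟧),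
      Triangle.mk f g h ∈ distTriang C → P X → P Z → P Y)
    (hiso : ∀ ⦃X Y : C⦄, (X ≅ Y) → P X → P Y) {E : C} (H : σ.HNFiltration E) : P E := by
  refine hiso H.top ?_
  have key : ∀ k : Fin (H.n + 1), P (H.X k) := by
    intro k
    induction k using Fin.induction with
    | zero => exact h0 _ H.zero
    | succ k ih => exact hext _ _ _ (H.distinguished k) ih (hs _ (H.semistable k))
  exact key _

/-- An involution acting trivially on the numerical Grothendieck group and leaving the stability
condition invariant preserves its heart. -/
theorem preservesHeart_of_isInvariant [IsTriangulated C] (T : C ⥤ C) [T.CommShift ℤ]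
    [T.IsTriangulated] (hT : Nonempty (T ⋙ T ≅ 𝟭 C)) (hZ : ∀ E, σ.charge (T.obj E) = σ.charge E)
    (hinv : IsInvariant σ T) {A B : C} (hA : σ.HeartSemistable A) (hZA : σ.charge A = -1)
    (hZB : σ.charge B = Complex.I) : PreservesHeart σ.t σ.t T := by
  obtain ⟨g, hg, hss⟩ := hinv
  obtain ⟨eT⟩ := hT
  -- The linear part fixes the real basis `-1`, `i` of `ℂ`, because the involution does not change
  -- charges.
  have hM : ∀ z : ℂ, g.M z = z := by
    have h1 : ∀ E, g.M (σ.charge E) = σ.charge E := fun E => by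
      have := hg E
      change σ.charge E = g.M.symm (σ.charge (T.obj E)) at this
      rw [hZ] at this
      rw [← LinearEquiv.eq_symm_apply]
      exact this
    intro z
    have h2 := h1 A
    have h3 := h1 B
    rw [hZA] at h2
    rw [hZB] at h3
    have hz : z = (-z.re) • (-1 : ℂ) + z.im • Complex.I := by
      apply Complex.ext <;> simp
    rw [hz, map_add, map_smul, map_smul, h2, h3]
  -- With trivial linear part, the lift to phases moves every `x` by an even integer.
  have hf : ∀ x : ℝ, ∃ n : ℤ, g.f x = x + 2 * n := by
    intro x
    obtain ⟨r, hr, h⟩ := g.compat x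
    rw [hM] at h
    have hr1 : r = 1 := by
      have := congrArg norm h
      rw [norm_mul] at this
      have e1 : ∀ y : ℝ, ‖Complex.exp (Real.pi * y * Complex.I)‖ = 1 := fun y => by
        rw [← Complex.ofReal_mul]; exact Complex.norm_exp_ofReal_mul_I _
      rw [e1, e1, mul_one, Complex.norm_real, Real.norm_eq_abs, abs_of_pos hr] at this
      exact this.symm
    rw [hr1, Complex.ofReal_one, one_mul] at h
    obtain ⟨n, hn⟩ := Complex.exp_eq_exp_iff_exists_int.1 h.symm
    refine ⟨n, ?_⟩
    have h2 : ((g.f x : ℝ) : ℂ) = ((x + 2 * n : ℝ) : ℂ) := by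
      have hpi : (Real.pi : ℂ) * Complex.I ≠ 0 :=
        mul_ne_zero (Complex.ofReal_ne_zero.2 Real.pi_ne_zero) Complex.I_ne_zero
      apply mul_left_cancel₀ hpi
      push_cast
      linear_combination hn
    exact_mod_cast h2
  set p := σ.heartPhase A with hp
  have hpm := heartPhase_mem _ hA.1 hA.2.1
  -- Applying the involution twice returns `A`, so `g.f (g.f p) = p`; an increasing map with this
  -- property fixes `p`.
  have hfp : g.f p = p := by
    have h1 := (hss _ _).1 ((hss _ _).1 (isSemistableOfPhase_heartPhase σ hA))
    have h2 : g.f (g.f p) = p :=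
      isSemistableOfPhase_unique σ (eT.app A) h1 (isSemistableOfPhase_heartPhase σ hA)
    rcases lt_trichotomy (g.f p) p with h | h | h
    · have := g.f.strictMono h
      linarith
    · exact h
    · have := g.f.strictMono h
      linarith
  -- Every `x` in `(0, 1]` lies between the fixed points `p - 1` and `p + 1`, on one side of the
  -- fixed point `p`; monotonicity then excludes a nonzero even translation.
  have hfx : ∀ x ∈ Set.Ioc (0 : ℝ) 1, g.f x = x := by
    intro x hx
    obtain ⟨n, hn⟩ := hf x
    have h1 := g.f_add_one p
    have h2 := g.f_add_one (p - 1)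
    rw [sub_add_cancel] at h2
    have h3 : g.f x ≤ g.f (p + 1) := g.f.monotone (by linarith [hx.2, hpm.1])
    have h4 : g.f (p - 1) ≤ g.f x := g.f.monotone (by linarith [hx.1, hpm.2])
    have h5 : (n : ℝ) < 1 := by
      rcases le_total x p with h | h
      · have := g.f.monotone h
        linarith [hx.1, hpm.2]
      · linarith [hx.1, hpm.2]
    have h6 : (-1 : ℝ) < n := by
      rcases le_total x p with h | h
      · linarith [hx.1, hpm.2]
      · have := g.f.monotone h
        linarith [hx.2, hpm.1]
    have h5' : n < 1 := by exact_mod_cast h5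
    have h6' : -1 < n := by exact_mod_cast h6
    obtain rfl : n = 0 := by lia
    simpa using hn
  intro E hE
  obtain ⟨H⟩ := σ.exists_HN E hE
  -- By Harder–Narasimhan filtrations it suffices to treat semistable objects, whose phase in `(0,
  -- 1]` is now known to be preserved.
  refine heart_induction_of_HNFiltration σ.toHeartWithStabilityFunction (fun E => σ.t.heart (T.obj E))
    (fun E h0 => heart_of_isZero (T.map_isZero h0)) (fun E hE => ?_)
    (fun X Y Z f g h hT hX hZ => heart_of_triangle (Functor.map_mk_distinguished T hT) hX hZ)
    (fun X Y e hX => heart_of_iso (T.mapIso e) hX) H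
  have h1 := (hss _ _).1 (isSemistableOfPhase_heartPhase σ hE)
  have hm := heartPhase_mem _ hE.1 hE.2.1
  rw [hfx _ hm] at h1
  exact (heart_of_isSemistableOfPhase σ hm h1).1

end Phases

/-! ### Vanishing of morphisms along a triangle. -/

section Vanishing

variable {C : Type u} [Category.{v} C] [HasZeroObject C] [HasShift C ℤ] [Preadditive C]
  [∀ n : ℤ, (shiftFunctor C n).Additive] [Pretriangulated C]

theorem hom_shift_obj₃_eq_zero {X Y Z S : C} {f : X ⟶ Y} {g : Y ⟶ Z} {h : Z ⟶ X⟦(1 : ℤ)⟧}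
    (hT : Triangle.mk f g h ∈ distTriang C) (n : ℤ) (hY : ∀ a : S ⟶ Y⟦n⟧, a = 0)
    (hX : ∀ a : S ⟶ X⟦n⟧⟦(1 : ℤ)⟧, a = 0) (a : S ⟶ Z⟦n⟧) : a = 0 := by
  obtain ⟨b, hb⟩ := Triangle.coyoneda_exact₃ _ (Triangle.shift_distinguished _ hT n) a (hX _)
  have hb0 : b = 0 := hY b
  subst hb0
  exact hb.trans zero_comp

theorem hom_shift_obj₁_eq_zero {X Y Z S : C} {f : X ⟶ Y} {g : Y ⟶ Z} {h : Z ⟶ X⟦(1 : ℤ)⟧}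
    (hT : Triangle.mk f g h ∈ distTriang C) (n : ℤ) (hY : ∀ a : S ⟶ Y⟦n⟧, a = 0)
    (hZ : ∀ a : S ⟶ Z⟦n⟧⟦(-1 : ℤ)⟧, a = 0) (a : S ⟶ X⟦n⟧) : a = 0 := by
  obtain ⟨b, hb⟩ := Triangle.coyoneda_exact₂ _
    (inv_rot_of_distTriang _ (Triangle.shift_distinguished _ hT n)) a (hY _)
  have hb0 : b = 0 := hZ b
  subst hb0
  exact hb.trans zero_comp

end Vanishing

/-! ### Bounding cohomology by the negativity of the Euler form. -/

section Amplitude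

open HeartWithStabilityFunction

variable {D : Type u'} [Category.{v'} D] [HasZeroObject D] [HasShift D ℤ] [Preadditive D]
  [∀ n : ℤ, (shiftFunctor D n).Additive] [Pretriangulated D] [Linear ℂ D]
  [∀ n : ℤ, (shiftFunctor D n).Linear ℂ] [IsFiniteType D]
  {τ : HeartWithStabilityFunction D}

/-- Serre duality turns these morphisms into morphisms from `X` to `S[2]`, which lies in degrees `≥
-2`. -/
theorem hom_eq_zero_of_isLE_neg_three (hS : IsSerreFunctor (shiftFunctor D (2 : ℤ))) {S X : D}
    (hSh : τ.t.heart S) (hX : τ.t.IsLE X (-3)) (f : S ⟶ X) : f = 0 := by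
  refine hS.hom_eq_zero (fun g => ?_) f
  have := ((heart_iff _).1 hSh).2
  have := τ.t.isGE_shift S 0 2 (-2)
  exact τ.t.zero g (-3) (-2)

/-- A degree `q` object without morphisms of degree `1` from two objects representing the basis of
the numerical Grothendieck group vanishes. -/
theorem isZero_of_hom_shift_eq_zero (L : Module.Basis (Fin 2) ℤ (KNum D))
    (hL : ∀ i j, euler D (L i) (L j) = if i = j then -2 else 0)
    (hZ : τ.Z (L 0) = -1 ∧ τ.Z (L 1) = Complex.I)
    (hS : IsSerreFunctor (shiftFunctor D (2 : ℤ))) {S : Fin 2 → D} (hSh : ∀ i, τ.t.heart (S i))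
    (hSL : ∀ i, cls (S i) = L i) {X : D} {q : ℤ} (hX₁ : τ.t.IsLE X q) (hX₂ : τ.t.IsGE X q)
    (h : ∀ i, ∀ f : S i ⟶ X⟦q + 1⟧, f = 0) : IsZero X := by
  have hH : τ.t.heart (X⟦q⟧) :=
    (heart_iff _).2 ⟨τ.t.isLE_shift X q q 0, τ.t.isGE_shift X q q 0⟩
  -- Odd degrees contribute nothing: negative ones by the t-structure, degree `1` by hypothesis,
  -- degrees `≥ 3` by Serre duality.
  have hchi : ∀ i, 0 ≤ chi (S i) (X⟦q⟧) := by
    intro i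
    refine chi_nonneg fun n hn f => ?_
    have := ((heart_iff _).1 (hSh i)).1
    have := ((heart_iff _).1 hH).1
    have := ((heart_iff _).1 hH).2
    rcases lt_trichotomy n 1 with h1 | rfl | h1
    · have := τ.t.isGE_shift (X⟦q⟧) 0 n (-n)
      have : n ≠ 0 := by rintro rfl; simp at hn
      exact τ.t.zero f 0 (-n)
    · rw [← cancel_mono ((shiftFunctorAdd' D q 1 (q + 1) rfl).inv.app X), zero_comp]
      exact h i _
    · obtain ⟨k, rfl⟩ := hn
      exact hom_eq_zero_of_isLE_neg_three hS (hSh i) (by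
        have := τ.t.isLE_shift (X⟦q⟧) 0 (2 * k + 1) (-(2 * k + 1))
        exact τ.t.isLE_of_le _ (-(2 * k + 1)) (-3)) f
  have hcls : cls (X⟦q⟧) = L.repr (cls (X⟦q⟧)) 0 • L 0 + L.repr (cls (X⟦q⟧)) 1 • L 1 := by
    conv_lhs => rw [← L.sum_repr (cls (X⟦q⟧))]
    rw [Fin.sum_univ_two]
  generalize L.repr (cls (X⟦q⟧)) 0 = a at hcls
  generalize L.repr (cls (X⟦q⟧)) 1 = b at hcls
  have h0 := hchi 0
  have h1 := hchi 1
  rw [← euler_cls, hSL, hcls, map_add, map_zsmul, map_zsmul, hL, hL] at h0 h1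
  simp only [smul_eq_mul, Fin.isValue, if_true, zero_ne_one, one_ne_zero, if_false] at h0 h1
  -- The Euler characteristics are `-2a` and `-2b`. Hence the charge `-a + bi` has real part `≥ 0`
  -- and imaginary part `≤ 0`, which no nonzero heart object allows.
  have ha : a ≤ 0 := by lia
  have hb : b ≤ 0 := by lia
  have hZX : τ.Z (cls (X⟦q⟧)) = -a + b * Complex.I := by
    rw [hcls, map_add, map_zsmul, map_zsmul, hZ.1, hZ.2]
    simp
  have hz : IsZero (X⟦q⟧) := by
    by_contra hne
    have hup := τ.upper_half_plane _ hH hne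
    rw [hZX] at hup
    have h0' : (a : ℝ) ≤ 0 := by exact_mod_cast ha
    have h1' : (b : ℝ) ≤ 0 := by exact_mod_cast hb
    simp at hup
    rcases hup with hup | hup
    · have : (0 : ℝ) < b := by exact_mod_cast hup
      linarith
    · have : (0 : ℝ) < a := by exact_mod_cast hup.2
      linarith
  exact ((shiftFunctor D (-q)).map_isZero hz).of_iso ((shiftEquiv D q).unitIso.app X)

/-- The extreme cohomology objects are removed one at a time: for the top degree `q ≥ 2` or the
bottom degree `q ≤ -2`, degree one morphisms from `S i` to the cohomology object are controlled by
morphisms from `S i` to `G` in degree `q + 1`, which lies in the vanishing range. -/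
theorem amplitude_of_hom_eq_zero [IsTriangulated D] (L : Module.Basis (Fin 2) ℤ (KNum D))
    (hL : ∀ i j, euler D (L i) (L j) = if i = j then -2 else 0)
    (hZ : τ.Z (L 0) = -1 ∧ τ.Z (L 1) = Complex.I)
    (hS : IsSerreFunctor (shiftFunctor D (2 : ℤ))) {S : Fin 2 → D} (hSh : ∀ i, τ.t.heart (S i))
    (hSL : ∀ i, cls (S i) = L i) {G : D}
    (hG : ∀ i, ∀ m : ℤ, m < 0 ∨ 3 ≤ m → ∀ f : S i ⟶ G⟦m⟧, f = 0) :
    τ.t.IsLE G 1 ∧ τ.t.IsGE G (-1) := by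
  constructor
  · have key : ∀ k : ℕ, τ.t.IsLE G (1 + k) → τ.t.IsLE G 1 := by
      intro k
      induction k with
      | zero => intro h; simpa using h
      | succ k ih =>
        intro h
        have h' : τ.t.IsLE G (k + 2) := by
          convert h using 1; push_cast; ring
        refine ih ?_
        rw [τ.t.isLE_iff_isZero_truncGE_obj (1 + k) (k + 2) (by ring)]
        refine isZero_of_hom_shift_eq_zero L hL hZ hS hSh hSL (q := k + 2) inferInstance
          inferInstance fun i => ?_
        -- Here `q + 1 = k + 3 ≥ 3`, and the remaining truncation, shifted by `k + 4`, lies in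
        -- degrees `≤ -3`.
        refine hom_shift_obj₃_eq_zero (τ.t.triangleLTGE_distinguished (k + 2) G) _
          (hG i _ (Or.inr (by lia))) fun a => hom_eq_zero_of_isLE_neg_three hS (hSh i) ?_ a
        have : τ.t.IsLE ((τ.t.truncLT (k + 2)).obj G) (k + 1) := τ.t.isLE_truncLT_obj ..
        have := τ.t.isLE_shift ((τ.t.truncLT (k + 2)).obj G) (k + 1) (k + 2 + 1) (-2)
        exact τ.t.isLE_shift _ (-2) 1 (-3)
    obtain ⟨n, hn⟩ := exists_isLE_of_bounded τ.bounded G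
    exact key n.natAbs (τ.t.isLE_of_le G n _)
  · have key : ∀ k : ℕ, τ.t.IsGE G (-1 - k) → τ.t.IsGE G (-1) := by
      intro k
      induction k with
      | zero => intro h; simpa using h
      | succ k ih =>
        intro h
        have h' : τ.t.IsGE G (-2 - k) := by
          convert h using 1; push_cast; ring
        refine ih ?_
        rw [τ.t.isGE_iff_isZero_truncLT_obj]
        refine isZero_of_hom_shift_eq_zero L hL hZ hS hSh hSL (q := -2 - k)
          (τ.t.isLE_truncLT_obj ..) inferInstance fun i => ?_
        refine hom_shift_obj₁_eq_zero (τ.t.triangleLTGE_distinguished (-1 - k) G) _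
          (hG i _ (Or.inl (by lia))) fun a => ?_
        have : τ.t.IsGE ((τ.t.truncGE (-1 - k)).obj G) (-1 - k) := inferInstance
        have := τ.t.isGE_shift ((τ.t.truncGE (-1 - k)).obj G) (-1 - k) (-2 - k + 1) 0
        have := τ.t.isGE_shift (((τ.t.truncGE (-1 - k)).obj G)⟦(-2 - k + 1 : ℤ)⟧) 0 (-1) 1
        have := ((heart_iff _).1 (hSh i)).1
        exact τ.t.zero a 0 1
    obtain ⟨n, hn⟩ := exists_isGE_of_bounded τ.bounded G
    exact key n.natAbs (τ.t.isGE_of_ge G _ n)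

end Amplitude

/-! ### From amplitude `[-1, 1]` to t-exactness. -/

section Exactness

open HeartWithStabilityFunction

variable {C : Type u} [Category.{v} C] [HasZeroObject C] [HasShift C ℤ] [Preadditive C]
  [∀ n : ℤ, (shiftFunctor C n).Additive] [Pretriangulated C] [Linear ℂ C]
  [∀ n : ℤ, (shiftFunctor C n).Linear ℂ] [IsFiniteType C]
  {D : Type u'} [Category.{v'} D] [HasZeroObject D] [HasShift D ℤ] [Preadditive D]
  [∀ n : ℤ, (shiftFunctor D n).Additive] [Pretriangulated D] [Linear ℂ D]
  [∀ n : ℤ, (shiftFunctor D n).Linear ℂ] [IsFiniteType D]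
  {σ : HeartWithStabilityFunction C} {τ : HeartWithStabilityFunction D}

/-- Functors of amplitude `[-1, 1]` whose composition preserves the heart are `t`-exact if the
second one acts on central charges by a positive number. -/
theorem preservesHeart_of_amplitude [IsTriangulated D] {F : C ⥤ D} {G : D ⥤ C}
    [G.CommShift ℤ] [G.IsTriangulated]
    (hF₁ : BoundedLE σ.t τ.t F 1) (hF₂ : BoundedGE σ.t τ.t F (-1))
    (hG₁ : BoundedLE τ.t σ.t G 1) (hG₂ : BoundedGE τ.t σ.t G (-1))
    (hGF : PreservesHeart σ.t σ.t (F ⋙ G)) {d : ℝ} (hd : 0 < d) (hZ : ScalesCharge τ σ G d) :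
    PreservesHeart σ.t τ.t F := by
  intro E hE
  have hE' := (heart_iff _).1 hE
  obtain ⟨hGFle, hGFge⟩ := (heart_iff _).1 (hGF E hE)
  change σ.t.IsLE (G.obj (F.obj E)) 0 at hGFle
  change σ.t.IsGE (G.obj (F.obj E)) 0 at hGFge
  have hle : τ.t.IsLE (F.obj E) 1 := by simpa using hF₁ E 0 hE'.1
  have hge : τ.t.IsGE (F.obj E) (-1) := by simpa using hF₂ E 0 hE'.2
  have zero_of : ∀ {H : D} {Y : C}, τ.t.heart H → σ.t.heart Y →
      σ.charge (G.obj H) = - σ.charge Y → IsZero H := by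
    intro H Y hH hY h
    by_contra hH0
    have h1 := (inHalfPlane hH hH0).smul hd
    rw [hZ] at h
    have h2 : (d * τ.charge H : ℂ) + σ.charge Y = 0 := by rw [h]; ring
    by_cases hY0 : IsZero Y
    · rw [charge_eq_zero hY0, add_zero] at h2
      exact h1.ne_zero h2
    · exact h1.add_ne_zero (inHalfPlane hY hY0) h2
  refine (heart_iff _).2 ⟨?_, ?_⟩
  · rw [τ.t.isLE_iff_isZero_truncGE_obj 0 1 rfl]
    -- `X` is concentrated in degree `1`. The triangle gives `G X ≤ 0` and the amplitude of `G`
    -- gives `G X ≥ 0`, so `G X` is in the heart together with `X[1]`, but with charges pointing in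
    -- opposite directions.
    set X := (τ.t.truncGE 1).obj (F.obj E)
    have hX₁ : τ.t.IsLE X 1 := inferInstance
    have hX₂ : τ.t.IsGE X 1 := inferInstance
    have hH : τ.t.heart (X⟦(1 : ℤ)⟧) :=
      (heart_iff _).2 ⟨τ.t.isLE_shift X 1 1 0, τ.t.isGE_shift X 1 1 0⟩
    have hT := Functor.map_mk_distinguished G (τ.t.triangleLTGE_distinguished 1 (F.obj E))
    have hA : τ.t.IsLE ((τ.t.truncLT 1).obj (F.obj E)) 0 := τ.t.isLE_truncLT_obj ..
    have h1 : σ.t.IsLE (G.obj X) 0 := isLE₃_of_triangle hT 0 (hG₁ _ 0 hA) hGFle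
    have h2 : σ.t.IsGE (G.obj X) 0 := by simpa using hG₂ X 1 hX₂
    have hz := zero_of hH ((heart_iff _).2 ⟨h1, h2⟩)
      (by rw [charge_iso (shiftObjIso G X 1), charge_shift_one])
    exact ((shiftFunctor D (-1 : ℤ)).map_isZero hz).of_iso ((shiftEquiv D (1 : ℤ)).unitIso.app X)
  · rw [τ.t.isGE_iff_isZero_truncLT_obj]
    set X := (τ.t.truncLT 0).obj (F.obj E)
    have hX₁ : τ.t.IsLE X (-1) := τ.t.isLE_truncLT_obj ..
    have hX₂ : τ.t.IsGE X (-1) := inferInstance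
    have hH : τ.t.heart (X⟦(-1 : ℤ)⟧) :=
      (heart_iff _).2 ⟨τ.t.isLE_shift X (-1) (-1) 0, τ.t.isGE_shift X (-1) (-1) 0⟩
    have hT := Functor.map_mk_distinguished G (τ.t.triangleLTGE_distinguished 0 (F.obj E))
    have hB : τ.t.IsGE ((τ.t.truncGE 0).obj (F.obj E)) 0 := inferInstance
    have h1 : σ.t.IsGE (G.obj X) 0 := isGE₁_of_triangle hT 0 hGFge (hG₂ _ 0 hB)
    have h2 : σ.t.IsLE (G.obj X) 0 := by simpa using hG₁ X (-1) hX₁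
    have hz := zero_of hH ((heart_iff _).2 ⟨h2, h1⟩) (by
      rw [charge_iso (shiftObjIso G X (-1)), charge_shift_neg_one])
    exact ((shiftFunctor D (1 : ℤ)).map_isZero hz).of_iso
      ((shiftEquiv D (1 : ℤ)).counitIso.app X).symm

end Exactness

/-! ### From hearts to arbitrary phases. -/

section Comparison

open HeartWithStabilityFunction

variable {C : Type u} [Category.{v} C] [HasZeroObject C] [HasShift C ℤ] [Preadditive C]
  [∀ n : ℤ, (shiftFunctor C n).Additive] [Pretriangulated C] [Linear ℂ C]
  [∀ n : ℤ, (shiftFunctor C n).Linear ℂ] [IsFiniteType C]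
  {D : Type u'} [Category.{v'} D] [HasZeroObject D] [HasShift D ℤ] [Preadditive D]
  [∀ n : ℤ, (shiftFunctor D n).Additive] [Pretriangulated D] [Linear ℂ D]
  [∀ n : ℤ, (shiftFunctor D n).Linear ℂ] [IsFiniteType D]
  {σ : StabilityCondition C} {τ : StabilityCondition D}

theorem scalesCharge_of_basis {ι : Type*} (l : Module.Basis ι ℤ (KNum C)) {F : C ⥤ D}
    {f : KNum C →+ KNum D} (hf : IsInducedMap F f) {c : ℝ}
    (h : ∀ i, τ.Z (f (l i)) = c * σ.Z (l i)) :
    ScalesCharge σ.toHeartWithStabilityFunction τ.toHeartWithStabilityFunction F c := by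
  intro E
  have h1 : (τ.Z.comp f).toIntLinearMap =
      ((AddMonoidHom.mulLeft (c : ℂ)).comp σ.Z).toIntLinearMap := l.ext h
  have h2 := LinearMap.congr_fun h1 (cls E)
  change τ.Z (f (cls E)) = c * σ.Z (cls E) at h2
  rw [hf] at h2
  exact h2

/-- A `t`-exact endofunctor preserving central charges with `T² ≅ 𝟭` preserves semistability. -/
theorem heartSemistable_obj_of_involution {T : C ⥤ C} [T.CommShift ℤ] [T.IsTriangulated]
    (hT : T ⋙ T ≅ 𝟭 C) (hheart : PreservesHeart σ.t σ.t T)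
    (hZ : ScalesCharge σ.toHeartWithStabilityFunction σ.toHeartWithStabilityFunction T 1) {E : C}
    (hE : σ.HeartSemistable E) : σ.HeartSemistable (T.obj E) :=
  heartSemistable_of_obj one_pos hheart hZ (hheart E hE.1) (hE.of_iso (hT.app E).symm)

/-- A `t`-exact endofunctor preserving central charges with `T² ≅ 𝟭` preserves stability. -/
theorem heartStable_obj_of_involution {T : C ⥤ C} [T.CommShift ℤ] [T.IsTriangulated]
    (hT : T ⋙ T ≅ 𝟭 C) (hheart : PreservesHeart σ.t σ.t T)
    (hZ : ScalesCharge σ.toHeartWithStabilityFunction σ.toHeartWithStabilityFunction T 1) {E : C}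
    (hE : σ.HeartStable E) : σ.HeartStable (T.obj E) :=
  heartStable_of_obj one_pos hheart hZ (hheart E hE.1) (hE.of_iso (hT.app E).symm)

variable {F : C ⥤ D} [F.CommShift ℤ] [F.IsTriangulated] {c : ℝ}

/-- For the converse, `F E ≅ B[n]` puts `F (E[-n])` in the heart; a t-exact functor without kernel
reflects the heart, and then semistability. -/
theorem isSemistableOfPhase_iff_obj [IsTriangulated C] (hc : 0 < c)
    (hF : PreservesHeart σ.t τ.t F)
    (hZ : ScalesCharge σ.toHeartWithStabilityFunction τ.toHeartWithStabilityFunction F c)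
    (h0 : ∀ X, IsZero (F.obj X) → IsZero X)
    (hss : ∀ E, σ.HeartSemistable E → τ.HeartSemistable (F.obj E)) (E : C) (φ : ℝ) :
    σ.IsSemistableOfPhase E φ ↔ τ.IsSemistableOfPhase (F.obj E) φ := by
  constructor
  · rintro ⟨A, n, hA, ⟨e⟩, rfl⟩
    exact ⟨F.obj A, n, hss A hA, ⟨F.mapIso e ≪≫ shiftObjIso F A n⟩,
      by rw [heartPhase_obj hc hZ]⟩
  · rintro ⟨B, n, hB, ⟨e⟩, rfl⟩
    obtain ⟨e'⟩ := nonempty_shift_neg_iso e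
    have i : F.obj (E⟦-n⟧) ≅ B := shiftObjIso F E (-n) ≪≫ e'
    have hFE := hB.of_iso i.symm
    refine ⟨E⟦-n⟧, n, heartSemistable_of_obj hc hF hZ
      (heart_of_heart_obj σ.bounded hF h0 hFE.1) hFE, nonempty_iso_shift_of_neg (Iso.refl _), ?_⟩
    rw [← heartPhase_obj hc hZ, heartPhase_iso i]

/-- `G` is the functor in the other direction. Hypothesis `hFG` says that objects `G Y` lose
stability under `F`, and `hG` that in the heart only they do; shifts carry this to all phases. -/
theorem isStable_obj_iff [IsTriangulated C] (hc : 0 < c) (hF : PreservesHeart σ.t τ.t F)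
    (hZ : ScalesCharge σ.toHeartWithStabilityFunction τ.toHeartWithStabilityFunction F c)
    (h0 : ∀ X, IsZero (F.obj X) → IsZero X) {G : D ⥤ C} [G.CommShift ℤ]
    (hFG : ∀ Y, τ.HeartStable Y → τ.t.heart (F.obj (G.obj Y)) ∧ ¬ τ.HeartStable (F.obj (G.obj Y)))
    (hG : ∀ E, σ.HeartStable E → ¬ τ.HeartStable (F.obj E) →
      ∃ Y, τ.HeartStable Y ∧ Nonempty (G.obj Y ≅ E)) (E : C) :
    τ.IsStable (F.obj E) ↔
      σ.IsStable E ∧ ∀ Y : D, τ.IsStable Y → ¬ Nonempty (G.obj Y ≅ E) := by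
  constructor
  · rintro ⟨_, B, n, hB, ⟨e⟩, rfl⟩
    obtain ⟨e'⟩ := nonempty_shift_neg_iso e
    have hFE := hB.of_iso (shiftObjIso F E (-n) ≪≫ e').symm
    refine ⟨⟨_, E⟦-n⟧, n, heartStable_of_obj hc hF hZ
      (heart_of_heart_obj σ.bounded hF h0 hFE.1) hFE, nonempty_iso_shift_of_neg (Iso.refl _), rfl⟩,
      ?_⟩
    rintro Y ⟨_, A, m, hA, ⟨a⟩, rfl⟩ ⟨i⟩
    have j : B⟦n⟧ ≅ (F.obj (G.obj A))⟦m⟧ :=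
      e.symm ≪≫ F.mapIso (i.symm ≪≫ G.mapIso a ≪≫ shiftObjIso G A m) ≪≫ shiftObjIso F _ m
    obtain rfl := shift_eq_of_heart hB.1 (hFG A hA).1 hB.2.1 j
    obtain ⟨j'⟩ := nonempty_iso_of_shift_iso j
    exact (hFG A hA).2 (hB.of_iso j')
  · rintro ⟨⟨_, A, n, hA, ⟨e⟩, rfl⟩, h⟩
    by_cases hFA : τ.HeartStable (F.obj A)
    · exact ⟨_, F.obj A, n, hFA, ⟨F.mapIso e ≪≫ shiftObjIso F A n⟩, rfl⟩
    · obtain ⟨Y, hY, ⟨i⟩⟩ := hG A hA hFA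
      refine absurd ⟨?_⟩ (h (Y⟦n⟧) ⟨_, Y, n, hY, ⟨Iso.refl _⟩, rfl⟩)
      exact shiftObjIso G Y n ≪≫ (shiftFunctor C n).mapIso i ≪≫ e.symm

end Comparison

end TriStab

/-! ### The main theorem. -/

theorem mainTheorem2
    -- `ℂ`-linear triangulated categories of finite type
    {K₁ : Type u} [Category.{v} K₁] [HasZeroObject K₁] [HasShift K₁ ℤ] [Preadditive K₁]
    [∀ n : ℤ, (shiftFunctor K₁ n).Additive] [Pretriangulated K₁] [IsTriangulated K₁]
    [Linear ℂ K₁] [∀ n : ℤ, (shiftFunctor K₁ n).Linear ℂ] [IsFiniteType K₁]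
    {K₂ : Type u'} [Category.{v'} K₂] [HasZeroObject K₂] [HasShift K₂ ℤ] [Preadditive K₂]
    [∀ n : ℤ, (shiftFunctor K₂ n).Additive] [Pretriangulated K₂] [IsTriangulated K₂]
    [Linear ℂ K₂] [∀ n : ℤ, (shiftFunctor K₂ n).Linear ℂ] [IsFiniteType K₂]
    -- the numerical Grothendieck groups and their Euler pairings
    (l : Module.Basis (Fin 2) ℤ (KNum K₁))
    (hl : ∀ i j, euler K₁ (l i) (l j) = if i = j then -1 else 0)
    (L : Module.Basis (Fin 2) ℤ (KNum K₂))
    (hL : ∀ i j, euler K₂ (L i) (L j) = if i = j then -2 else 0)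
    -- the involutions
    (T₁ : K₁ ⥤ K₁) [T₁.CommShift ℤ] [T₁.IsTriangulated] [T₁.Linear ℂ] [T₁.IsEquivalence]
    (hT₁ : Nonempty (T₁ ⋙ T₁ ≅ 𝟭 K₁)) (hT₁num : IsInducedMap T₁ (AddMonoidHom.id (KNum K₁)))
    (T₂ : K₂ ⥤ K₂) [T₂.CommShift ℤ] [T₂.IsTriangulated] [T₂.Linear ℂ] [T₂.IsEquivalence]
    (hT₂ : Nonempty (T₂ ⋙ T₂ ≅ 𝟭 K₂)) (hT₂num : IsInducedMap T₂ (AddMonoidHom.id (KNum K₂)))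
    -- the Serre functors `T₁ ∘ [2]` and `[2]`
    (hS₁ : IsSerreFunctor (shiftFunctor K₁ (2 : ℤ) ⋙ T₁))
    (hS₂ : IsSerreFunctor (shiftFunctor K₂ (2 : ℤ)))
    -- the adjoint functors `Φ^* = pull` and `Φ_* = push`
    (pull : K₂ ⥤ K₁) [pull.CommShift ℤ] [pull.IsTriangulated] [pull.Linear ℂ]
    (push : K₁ ⥤ K₂) [push.CommShift ℤ] [push.IsTriangulated] [push.Linear ℂ]
    (hadj₁ : Nonempty (T₁ ⋙ push ⊣ pull)) (hadj₂ : Nonempty (pull ⊣ push))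
    (hpush : ∃ f : KNum K₁ →+ KNum K₂, IsInducedMap push f ∧ ∀ i, f (l i) = L i)
    (hpull : ∃ f : KNum K₂ →+ KNum K₁, IsInducedMap pull f ∧ ∀ i, f (L i) = 2 • l i)
    (hcomm : ∀ F : K₂, Nonempty (pull.obj (T₂.obj F) ≅ T₁.obj (pull.obj F)))
    -- the stability conditions
    (σ₁ : StabilityCondition K₁) (σ₂ : StabilityCondition K₂)
    (hinv₁ : IsInvariant σ₁ T₁) (hinv₂ : IsInvariant σ₂ T₂)
    (hZ₁ : σ₁.Z (l 0) = -1 ∧ σ₁.Z (l 1) = Complex.I)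
    (hZ₂ : σ₂.Z (L 0) = -1 ∧ σ₂.Z (L 1) = Complex.I)
    (hinf : ∀ i, {x : Quotient (isIsomorphicSetoid K₁) |
      ∃ E : K₁, x = Quotient.mk _ E ∧ σ₁.HeartStable E ∧ cls E = l i}.Infinite)
    (hstab : ∀ (i : Fin 2) (E : K₁) (φ : ℝ), cls E = l i →
      σ₁.IsStableOfPhase E φ → σ₂.IsStableOfPhase (push.obj E) φ)
    -- the exact triangles `T₁ E → Φ^* Φ_* E → E` and `F → Φ_* Φ^* F → T₂ F`
    (htri₁ : ∀ E : K₁, ∃ (a : T₁.obj E ⟶ pull.obj (push.obj E)) (b : pull.obj (push.obj E) ⟶ E)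
      (c : E ⟶ (T₁.obj E)⟦(1 : ℤ)⟧), Triangle.mk a b c ∈ distTriang K₁)
    (htri₂ : ∀ F : K₂, ∃ (a : F ⟶ push.obj (pull.obj F)) (b : push.obj (pull.obj F) ⟶ T₂.obj F)
      (c : T₂.obj F ⟶ F⟦(1 : ℤ)⟧), Triangle.mk a b c ∈ distTriang K₂) :
    (∀ (E : K₁) (φ : ℝ), σ₁.IsSemistableOfPhase E φ ↔ σ₂.IsSemistableOfPhase (push.obj E) φ) ∧
    (∀ E : K₁, σ₂.IsStable (push.obj E) ↔
      σ₁.IsStable E ∧ ∀ F : K₂, σ₂.IsStable F → ¬ Nonempty (pull.obj F ≅ E)) ∧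
    (∀ (F : K₂) (φ : ℝ), σ₂.IsSemistableOfPhase F φ ↔ σ₁.IsSemistableOfPhase (pull.obj F) φ) ∧
    (∀ F : K₂, σ₁.IsStable (pull.obj F) ↔
      σ₂.IsStable F ∧ ∀ E : K₁, σ₁.IsStable E → ¬ Nonempty (push.obj E ≅ F)) := by
  obtain ⟨eT₁⟩ := hT₁
  obtain ⟨eT₂⟩ := hT₂
  obtain ⟨adj₁⟩ := hadj₁
  obtain ⟨adj₂⟩ := hadj₂
  obtain ⟨f, hf, hfl⟩ := hpush
  obtain ⟨f', hf', hfL⟩ := hpull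
  have hA : ∀ i, ∃ A : K₁, σ₁.HeartStable A ∧ cls A = l i := fun i => by
    obtain ⟨_, A, -, h1, h2⟩ := (hinf i).nonempty
    exact ⟨A, h1, h2⟩
  choose A hAs hAl using hA
  -- Preservation of the phase, which lies in `(0, 1]`, places `push (A i)` in the heart itself and
  -- not in a shift. These are the test objects for the amplitude bound.
  have hSs : ∀ i, σ₂.HeartStable (push.obj (A i)) := fun i =>
    heartStable_of_isStableOfPhase σ₂ (heartPhase_mem _ (hAs i).1 (hAs i).2.1)
      (hstab i _ _ (hAl i) (isStableOfPhase_heartPhase σ₁ (hAs i)))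
  have hSL : ∀ i, cls (push.obj (A i)) = L i := fun i => by rw [← hf, hAl, hfl]
  have hZZ : ∀ i, σ₂.Z (L i) = σ₁.Z (l i) := by
    rw [Fin.forall_fin_two]
    exact ⟨by rw [hZ₁.1, hZ₂.1], by rw [hZ₁.2, hZ₂.2]⟩
  have hpushZ : ScalesCharge σ₁.toHeartWithStabilityFunction σ₂.toHeartWithStabilityFunction
      push 1 := scalesCharge_of_basis l hf fun i => by rw [hfl, hZZ]; simp
  have hpullZ : ScalesCharge σ₂.toHeartWithStabilityFunction σ₁.toHeartWithStabilityFunction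
      pull 2 := scalesCharge_of_basis L hf' fun i => by rw [hfL, hZZ, map_nsmul]; simp
  have hT₁Z : ScalesCharge σ₁.toHeartWithStabilityFunction σ₁.toHeartWithStabilityFunction
      T₁ 1 := scalesCharge_of_basis l hT₁num fun i => by simp
  have hT₂Z : ScalesCharge σ₂.toHeartWithStabilityFunction σ₂.toHeartWithStabilityFunction
      T₂ 1 := scalesCharge_of_basis L hT₂num fun i => by simp
  have hT₁Z' : ∀ E, σ₁.charge (T₁.obj E) = σ₁.charge E := fun E => by rw [hT₁Z]; simp
  have hT₂Z' : ∀ E, σ₂.charge (T₂.obj E) = σ₂.charge E := fun E => by rw [hT₂Z]; simp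
  have hT₁h : PreservesHeart σ₁.t σ₁.t T₁ :=
    preservesHeart_of_isInvariant σ₁ T₁ ⟨eT₁⟩ hT₁Z' hinv₁ (hAs 0).heartSemistable
      (B := A 1) ((congrArg σ₁.Z (hAl 0)).trans hZ₁.1) ((congrArg σ₁.Z (hAl 1)).trans hZ₁.2)
  have hT₂h : PreservesHeart σ₂.t σ₂.t T₂ :=
    preservesHeart_of_isInvariant σ₂ T₂ ⟨eT₂⟩ hT₂Z' hinv₂ (hSs 0).heartSemistable
      (B := push.obj (A 1)) ((congrArg σ₂.Z (hSL 0)).trans hZ₂.1)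
      ((congrArg σ₂.Z (hSL 1)).trans hZ₂.2)
  have hpp : PreservesHeart σ₁.t σ₁.t (push ⋙ pull) := fun E hE => by
    obtain ⟨a, b, c, hT⟩ := htri₁ E
    exact heart_of_triangle hT (hT₁h E hE) hE
  -- the functors have amplitude `[-1, 1]`
  have hamp : ∀ E, σ₁.t.heart E → σ₂.t.IsLE (push.obj E) 1 ∧ σ₂.t.IsGE (push.obj E) (-1) := by
    intro E hE
    refine amplitude_of_hom_eq_zero L hL hZ₂ hS₂ (fun i => (hSs i).1) hSL fun i m hm g => ?_
    have hE' := (heart_iff _).1 hE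
    have hA' := (heart_iff _).1 (hpp _ (hAs i).1)
    -- After adjunction both objects come from the heart of `K₁`. For `m ≥ 3`, the Serre dual
    -- morphisms go from degrees `≤ -3` to degrees `≥ -2`.
    have key : ∀ g : pull.obj (push.obj (A i)) ⟶ E⟦m⟧, g = 0 := by
      intro g
      rcases hm with hm | hm
      · exact hom_shift_eq_zero_of_heart (hpp _ (hAs i).1) hE hm g
      · refine hS₁.hom_eq_zero (fun b => ?_) g
        obtain ⟨-, _⟩ := hA'
        obtain ⟨_, -⟩ := hE'
        have h1 := σ₁.t.isGE_shift ((push ⋙ pull).obj (A i)) 0 2 (-2)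
        have h2 := hT₁h.boundedGE σ₁.bounded _ (-2) h1
        have h3 := σ₁.t.isLE_shift E 0 m (-m)
        exact σ₁.t.zero_of_isLE_of_isGE b (-m) (-2 + 0) (by lia) h3 h2
    rw [← cancel_mono (shiftObjIso push E m).inv, zero_comp]
    exact (adj₂.homAddEquiv _ _).symm.map_eq_zero_iff.1 (key _)
  have hpush₁ : BoundedLE σ₁.t σ₂.t push 1 := boundedLE_of_heart σ₁.bounded push fun E hE =>
    (hamp E hE).1
  have hpush₂ : BoundedGE σ₁.t σ₂.t push (-1) := boundedGE_of_heart σ₁.bounded push fun E hE =>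
    (hamp E hE).2
  have hTpush : ∀ k, BoundedLE σ₁.t σ₂.t push k → BoundedLE σ₁.t σ₂.t (T₁ ⋙ push) k :=
    fun k h X n hX => by
      have := h _ _ (hT₁h.boundedLE σ₁.bounded X n hX)
      rwa [add_zero] at this
  have hpush₀ : PreservesHeart σ₁.t σ₂.t push :=
    -- As a left adjoint of `push`, `pull` is bounded above by `1`; as a right adjoint of `T₁ ⋙
    -- push`, it is bounded below by `-1`.
    preservesHeart_of_amplitude hpush₁ hpush₂ (boundedLE_of_adjunction adj₂ hpush₂)
      (boundedGE_of_adjunction adj₁ (hTpush 1 hpush₁)) hpp two_pos hpullZ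
  have hpull₀ : PreservesHeart σ₂.t σ₁.t pull := preservesHeart_of_bounded
    (boundedLE_of_adjunction adj₂ (hpush₀.boundedGE σ₁.bounded))
    (boundedGE_of_adjunction adj₁ (hTpush 0 (hpush₀.boundedLE σ₁.bounded)))
  -- the functors have no kernel
  have hpush_zero : ∀ X, IsZero (push.obj X) → IsZero X := fun X hX => by
    obtain ⟨a, b, c, hT⟩ := htri₁ X
    -- The middle term of the triangle vanishes, so `X ≅ (T₁ X)[1]`; applying this twice gives `X ≅
    -- X[2]`.
    have hc : IsIso c := (Triangle.isZero₂_iff_isIso₃ _ hT).1 (pull.map_isZero hX)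
    exact isZero_of_iso_shift_two (asIso c ≪≫ (shiftFunctor K₁ (1 : ℤ)).mapIso (T₁.mapIso (asIso c)
      ≪≫ shiftObjIso T₁ _ 1 ≪≫ (shiftFunctor K₁ (1 : ℤ)).mapIso (eT₁.app X)) ≪≫
      ((shiftFunctorAdd' K₁ (1 : ℤ) 1 2 rfl).app X).symm)
  have hpull_zero : ∀ X, IsZero (pull.obj X) → IsZero X := fun X hX => by
    obtain ⟨a, b, c, hT⟩ := htri₂ X
    have hc : IsIso c := (Triangle.isZero₂_iff_isIso₃ _ hT).1 (push.map_isZero hX)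
    exact isZero_of_iso_shift_two ((eT₂.app X).symm ≪≫ T₂.mapIso (asIso c) ≪≫
      shiftObjIso T₂ _ 1 ≪≫ (shiftFunctor K₂ (1 : ℤ)).mapIso (asIso c) ≪≫
      ((shiftFunctorAdd' K₂ (1 : ℤ) 1 2 rfl).app X).symm)
  -- semistability
  have hpush_ss : ∀ E, σ₁.HeartSemistable E → σ₂.HeartSemistable (push.obj E) := fun E hE => by
    obtain ⟨a, b, c, hT⟩ := htri₁ E
    exact heartSemistable_of_obj two_pos hpull₀ hpullZ (hpush₀ E hE.1) (.of_extension hT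
      (heartSemistable_obj_of_involution eT₁ hT₁h hT₁Z hE) hE (hT₁Z' E))
  have hpull_ss : ∀ F, σ₂.HeartSemistable F → σ₁.HeartSemistable (pull.obj F) := fun F hF => by
    obtain ⟨a, b, c, hT⟩ := htri₂ F
    exact heartSemistable_of_obj one_pos hpush₀ hpushZ (hpull₀ F hF.1) (.of_extension hT hF
      (heartSemistable_obj_of_involution eT₂ hT₂h hT₂Z hF) (hT₂Z' F).symm)
  refine ⟨isSemistableOfPhase_iff_obj one_pos hpush₀ hpushZ hpush_zero hpush_ss,
    isStable_obj_iff one_pos hpush₀ hpushZ hpush_zero (fun Y hY => ⟨hpush₀ _ (hpull₀ _ hY.1), ?_⟩)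
      fun E hE hE' => ?_,
    isSemistableOfPhase_iff_obj two_pos hpull₀ hpullZ hpull_zero hpull_ss,
    isStable_obj_iff two_pos hpull₀ hpullZ hpull_zero (fun Y hY => ⟨hpull₀ _ (hpush₀ _ hY.1), ?_⟩)
      fun F hF hF' => ?_⟩
  · obtain ⟨a, b, c, hT⟩ := htri₂ Y
    have hTY := heartStable_obj_of_involution eT₂ hT₂h hT₂Z hY
    exact HeartWithStabilityFunction.not_heartStable_of_extension hT hY.1 hTY.1
      (hT₂Z' Y).symm hTY.2.1
  · have eP : T₁ ⋙ T₁ ⋙ push ≅ push := Functor.isoWhiskerRight eT₁ push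
    -- Being its own inverse, `T₁` is self-adjoint; this turns the left adjoint `T₁ ⋙ push` of
    -- `pull` into a right adjoint `pull ⋙ T₁` of `push`.
    have adjT : T₁ ⊣ T₁ := (CategoryTheory.Equivalence.mk T₁ T₁ eT₁.symm eT₁).toAdjunction
    refine exists_heartStable_of_not_heartStable adj₂ (R := pull ⋙ T₁)
      ((adjT.comp adj₁).ofNatIsoLeft eP) two_pos (by norm_num) hpushZ hpullZ
      (fun Y => ?_) hpull_ss (fun Y hY => ?_) hE (hpush_ss E hE.heartSemistable) hE'
    · exact (hT₁Z' _).trans (hpullZ Y)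
    · exact heartSemistable_obj_of_involution eT₁ hT₁h hT₁Z (hpull_ss Y hY)
  · obtain ⟨a, b, c, hT⟩ := htri₁ Y
    exact HeartWithStabilityFunction.not_heartStable_of_extension hT (hT₁h _ hY.1)
      hY.1 (hT₁Z' Y) hY.2.1
  -- The left adjoint of `pull` is `T₁ ⋙ push`, so the stable object whose push-forward is `F` is
  -- `T₁ Y`.
  · obtain ⟨Y, hY, ⟨i⟩⟩ := exists_heartStable_of_not_heartStable adj₁ adj₂ one_pos (by norm_num)
      hpullZ (fun Y => by rw [Functor.comp_obj, hpushZ, hT₁Z']) hpushZ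
      (fun Y hY => hpush_ss _ (heartSemistable_obj_of_involution eT₁ hT₁h hT₁Z hY)) hpush_ss
      hF (hpull_ss F hF.heartSemistable) hF'
    exact ⟨T₁.obj Y, heartStable_obj_of_involution eT₁ hT₁h hT₁Z hY, ⟨i⟩⟩
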